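/- Let $?:[0,1]\to[0,1]$ be the Minkowski question mark function: the continuous increasing function with $?(0)=0$, $?(1)=1$ and $?\left(\frac{p+p'}{q+q'}\right)=\frac12\left(?\left(\frac pq\right)+?\left(\frac{p'}{q'}\right)\right)$ for all consecutive Farey fractions $\frac pq,\frac{p'}{q'}$ in $[0,1]$. For an irrational $x\in(0,1)$ with regular continued fraction expansion $x=[0;a_1,a_2,\dots]$ and a natural number $t$ put $S_x(t)=a_1+\dots+a_t$. Let $E_n$ be the set of the irrational $x\in(0,1)$ all of whose partial quotients satisfy $a_j\le n$. Put $\lambda_1=\frac{1+\sqrt5}{2}$, $\mu_n=\frac{n+2+\sqrt{n^2+4n}}{2}$ and, for $n\ge5$, $$\kappa_n=\frac{(n+1)\log\lambda_1-\log\mu_n}{(n-1)\log\sqrt2-\log\mu_n+2\log\lambda_1}.$$ Theorem 6. Let $n\ge5$ be an integer. (i) Let $x\in E_n$ be such that the derivative $?'(x)$ exists and $?'(x)=0$. Then there is $T=T(n,x)$ such that for all natural $t\ge T$ $$\max_{1\le u\le t}\left(S_x(u)-\kappa_n u\right)\ge\frac{\sqrt t}{160\,(n+2)^{10}},$$ where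 $u$ runs through the natural numbers. (ii) There exists $x\in E_n$ such that the derivative $?'(x)$ exists, $?'(x)=0$, and for all sufficiently large natural $t$ $$S_x(t)-\kappa_n t\le 15\,n\sqrt t.$$ -/

import Mathlib

namespace Minkowski

noncomputable section

/-- The Stern-Brocot sequence of level `m`: `sternBrocot m k = (p, q)` where, for `k ≤ 2 ^ m`, the
fraction `p / q` is the `k`-th element (counted from `0`, in increasing order) of the set `F_m`.
Level `0` is `0/1, 1/1`; the next level keeps all the fractions of the level (at even indices)
and inserts between any two neighbours their mediant (at odd indices). -/
def sternBrocot : ℕ → ℕ → ℕ × ℕ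
  | 0, k => (k, 1)
  | m + 1, k =>
    if k % 2 = 0 then sternBrocot m (k / 2)
    else ((sternBrocot m (k / 2)).1 + (sternBrocot m (k / 2 + 1)).1,
      (sternBrocot m (k / 2)).2 + (sternBrocot m (k / 2 + 1)).2)

/-- The `k`-th fraction of the Stern-Brocot sequence of level `m`, as a real number. -/
def sternBrocotPoint (m k : ℕ) : ℝ := ((sternBrocot m k).1 : ℝ) / ((sternBrocot m k).2 : ℝ)

/-- Minkowski's question mark function. The conditions `?(0) = 0`, `?(1) = 1` and
`?((p + p') / (q + q')) = (?(p / q) + ?(p' / q')) / 2` for neighbours `p / q`, `p' / q'` say that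
the `k`-th fraction of level `m` has the value `k / 2 ^ m`; the increasing continuous extension to
`[0, 1]` takes at `x` the supremum of the values at the fractions that are at most `x`.
(Outside `[0, 1]` it is constant: `0` on the left and `1` on the right.) -/
def questionMark (x : ℝ) : ℝ :=
  sSup {y : ℝ | ∃ m k : ℕ, k ≤ 2 ^ m ∧ sternBrocotPoint m k ≤ x ∧ y = (k : ℝ) / 2 ^ m}

/-- The partial quotient `a_{j+1}` of `x = [a_0; a_1, a_2, …]` (so `j = 0` gives `a_1`); it is set
to `0` if the expansion stops earlier, which does not happen for irrational `x`. -/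
def partialQuotient (x : ℝ) (j : ℕ) : ℝ := ((GenContFract.of x).partDens.get? j).getD 0

/-- `S_x(t) = a_1 + … + a_t`. -/
def quotientSum (x : ℝ) (t : ℕ) : ℝ := ∑ j ∈ Finset.range t, partialQuotient x j

/-- The set `E_n` of the irrational `x ∈ (0, 1)` whose partial quotients are all at most `n`. -/
def boundedQuotients (n : ℕ) : Set ℝ :=
  {x : ℝ | x ∈ Set.Ioo (0 : ℝ) 1 ∧ Irrational x ∧ ∀ j : ℕ, partialQuotient x j ≤ (n : ℝ)}

/-- `λ_j = (j + √(j² + 4)) / 2`. -/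
def lam (j : ℕ) : ℝ := ((j : ℝ) + √((j : ℝ) ^ 2 + 4)) / 2

/-- `μ_j = (j + 2 + √(j² + 4 j)) / 2`. -/
def mu (j : ℕ) : ℝ := ((j : ℝ) + 2 + √((j : ℝ) ^ 2 + 4 * (j : ℝ))) / 2

/-- The constant `κ_n` for `n ≥ 5`. -/
def kappa (n : ℕ) : ℝ :=
  (((n : ℝ) + 1) * Real.log (lam 1) - Real.log (mu n)) /
    (((n : ℝ) - 1) * Real.log (√2) - Real.log (mu n) + 2 * Real.log (lam 1))

end

end Minkowski

namespace Minkowski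

open Filter Topology

/-! Let `q_t` be the denominators of the convergents of `x`. For each `t`, `x` lies between two
Stern-Brocot neighbours at distance `1/(q_t q_{t+1})`, over which `?` grows by `2^(1 - S_x(t+1))`.
For bounded partial quotients, `?'(x) = 0` therefore forces `q_t^2 = O(2^S_x(t))`, and `q_t^2 =
o(2^S_x(t))` suffices for it (`IsExpansion.convDen_sq_le`, `IsExpansion.hasDerivAt_zero`). The rest
is about the growth of `q_t` for given `S` and `t`.

The sequences `1, 1, 1, …` and `n, 1, n, 1, …` have growth factor `λ₁` per letter and `μ_n` per
block. Give the letter `a` the weight `exp (slope n * a + offset n)`, which is `λ₁` at `1` and `μ_n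
/ λ₁` at `n`. The `antinorm` of `(q_t, q_{t-1})` grows at each step by at least the weight of the
letter, so `relativeGrowth` is nondecreasing. The number `κ_n` is such that `2^(S/2)` is the product
of the weights times `exp (excess)`, where `excess` is a positive multiple of `S - κ_n t`.

(i) The bound on `q_t` gives `0 ≤ relativeGrowth ≤ B + excess`, so `excess ≥ -B`. Suppose `excess ≤
M` up to `t`. A long run of `1` lowers the excess and a long run of blocks `n, 1` raises it, so each
window of length of order `M` must contain another pattern, and such a pattern adds a fixed amount
to `relativeGrowth`. There are about `t / M` windows and at most about `M` to gain, so `M` is at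
least of order `√t`.

(ii) Conversely, stage `j` writes `j + d` blocks `n, 1` and then letters `1` until the excess falls
to `j`. Each stage costs at most one more factor `λ₁` in the bound for `q_t` over the weights, while
the excess stays above `j - 1 - lossOne`; as `λ₁ < e`, the derivative vanishes. The excess is `O(j)`
and `t` is at least of order `j^2`. -/

/-! ### Stern-Brocot neighbours and the values of `?` at them -/

theorem sternBrocot_even (m k : ℕ) : sternBrocot (m + 1) (2 * k) = sternBrocot m k := by
  simp [sternBrocot]

theorem sternBrocot_odd (m k : ℕ) :
    sternBrocot (m + 1) (2 * k + 1) = sternBrocot m k + sternBrocot m (k + 1) := by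
  have h1 : (2 * k + 1) % 2 ≠ 0 := by omega
  have h2 : (2 * k + 1) / 2 = k := by omega
  rw [sternBrocot, if_neg h1, h2]
  rfl

theorem sternBrocot_refine (m j k : ℕ) : sternBrocot (m + j) (2 ^ j * k) = sternBrocot m k := by
  induction j with
  | zero => simp
  | succ j ih => rw [← ih, pow_succ', mul_assoc, ← add_assoc, sternBrocot_even]

theorem sternBrocot_refine_right (m j k : ℕ) :
    sternBrocot (m + j) (2 ^ j * k + 1) = j • sternBrocot m k + sternBrocot m (k + 1) := by
  induction j with
  | zero => simp
  | succ j ih =>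
    rw [pow_succ', mul_assoc, ← add_assoc, sternBrocot_odd, ih, sternBrocot_refine, succ_nsmul']
    abel

theorem sternBrocot_refine_left (m j k : ℕ) : ∃ l, l + 1 = 2 ^ j * (k + 1) ∧
    sternBrocot (m + j) l = sternBrocot m k + j • sternBrocot m (k + 1) := by
  induction j with
  | zero => exact ⟨k, by simp, by simp⟩
  | succ j ih =>
    obtain ⟨l, hl, h⟩ := ih
    refine ⟨2 * l + 1, by rw [pow_succ']; linarith, ?_⟩
    rw [← add_assoc, sternBrocot_odd, h, hl, sternBrocot_refine, succ_nsmul]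
    abel

theorem sternBrocot_zero_right (m : ℕ) : sternBrocot m 0 = (0, 1) := by
  simpa [sternBrocot] using sternBrocot_refine 0 m 0

theorem sternBrocot_one_right (m : ℕ) : sternBrocot m 1 = (1, m + 1) := by
  have := sternBrocot_refine_right 0 m 0
  simp only [zero_add, mul_zero, sternBrocot] at this
  rw [this]
  ext <;> simp

theorem sternBrocot_den_pos (m k : ℕ) : 0 < (sternBrocot m k).2 := by
  induction m generalizing k with
  | zero => simp [sternBrocot]
  | succ m ih =>
    rw [sternBrocot]
    split_ifs
    · exact ih _
    · have := ih (k / 2)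
      simp only
      omega

theorem sternBrocot_det (m k : ℕ) :
    (sternBrocot m (k + 1)).1 * (sternBrocot m k).2
      = (sternBrocot m k).1 * (sternBrocot m (k + 1)).2 + 1 := by
  induction m generalizing k with
  | zero => simp [sternBrocot]
  | succ m ih =>
    rcases Nat.even_or_odd' k with ⟨l, rfl | rfl⟩
    · rw [sternBrocot_odd, sternBrocot_even]
      have := ih l
      simp only [Prod.fst_add, Prod.snd_add]
      nlinarith
    · rw [show 2 * l + 1 + 1 = 2 * (l + 1) by ring, sternBrocot_odd, sternBrocot_even]
      have := ih l
      simp only [Prod.fst_add, Prod.snd_add]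
      nlinarith

theorem sternBrocotPoint_succ_sub (m k : ℕ) :
    sternBrocotPoint m (k + 1) - sternBrocotPoint m k
      = 1 / ((sternBrocot m k).2 * (sternBrocot m (k + 1)).2) := by
  have h1 : (0 : ℝ) < (sternBrocot m k).2 := by exact_mod_cast sternBrocot_den_pos m k
  have h2 : (0 : ℝ) < (sternBrocot m (k + 1)).2 := by
    exact_mod_cast sternBrocot_den_pos m (k + 1)
  have h3 : ((sternBrocot m (k + 1)).1 : ℝ) * (sternBrocot m k).2
      = (sternBrocot m k).1 * (sternBrocot m (k + 1)).2 + 1 := by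
    exact_mod_cast sternBrocot_det m k
  unfold sternBrocotPoint
  field_simp
  linarith

/-- Monotonicity holds in all `k`, not only up to `2 ^ m`, because level `0` continues as `2/1, 3/1,
…` with the same determinant. -/
theorem sternBrocotPoint_strictMono (m : ℕ) : StrictMono (sternBrocotPoint m) := by
  refine strictMono_nat_of_lt_succ fun k => ?_
  have h1 : (0 : ℝ) < (sternBrocot m k).2 := by exact_mod_cast sternBrocot_den_pos m k
  have h2 : (0 : ℝ) < (sternBrocot m (k + 1)).2 := by
    exact_mod_cast sternBrocot_den_pos m (k + 1)
  have := sternBrocotPoint_succ_sub m k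
  have : 0 < 1 / (((sternBrocot m k).2 : ℝ) * (sternBrocot m (k + 1)).2) := by positivity
  linarith

theorem sternBrocotPoint_refine (m j k : ℕ) :
    sternBrocotPoint (m + j) (2 ^ j * k) = sternBrocotPoint m k := by
  simp only [sternBrocotPoint, sternBrocot_refine]

theorem bddAbove_questionMark_set (x : ℝ) :
    BddAbove {y : ℝ | ∃ m k : ℕ, k ≤ 2 ^ m ∧ sternBrocotPoint m k ≤ x ∧ y = (k : ℝ) / 2 ^ m} := by
  refine ⟨1, ?_⟩
  rintro y ⟨m, k, hk, -, rfl⟩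
  rw [div_le_one (by positivity)]
  exact_mod_cast hk

theorem sternBrocotPoint_zero_right (m : ℕ) : sternBrocotPoint m 0 = 0 := by
  simp [sternBrocotPoint, sternBrocot_zero_right]

theorem questionMark_mono {x y : ℝ} (hx : 0 ≤ x) (hxy : x ≤ y) :
    questionMark x ≤ questionMark y := by
  refine csSup_le_csSup (bddAbove_questionMark_set y) ?_ ?_
  · exact ⟨0, 0, 0, by simp, by simpa [sternBrocotPoint_zero_right] using hx, by simp⟩
  · rintro _ ⟨m, k, hk, h, rfl⟩
    exact ⟨m, k, hk, h.trans hxy, rfl⟩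

theorem questionMark_sternBrocotPoint {m k : ℕ} (hk : k ≤ 2 ^ m) :
    questionMark (sternBrocotPoint m k) = (k : ℝ) / 2 ^ m := by
  refine IsGreatest.csSup_eq ⟨⟨m, k, hk, le_rfl, rfl⟩, ?_⟩
  rintro _ ⟨m', k', -, h, rfl⟩
  -- Both fractions are moved to the common level `m + m'`, where order of points is order of
  -- indices.
  rw [← sternBrocotPoint_refine m m' k, ← sternBrocotPoint_refine m' m k', add_comm m' m,
    (sternBrocotPoint_strictMono _).le_iff_le] at h
  rw [div_le_div_iff₀ (by positivity) (by positivity)]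
  have : ((2 ^ m * k' : ℕ) : ℝ) ≤ (2 ^ m' * k : ℕ) := by exact_mod_cast h
  push_cast at this
  linarith

/-! ### Convergents and their denominators -/

/-- The convergents of `[0; a 0, a 1, …]` as pairs (numerator, denominator), with the index shifted
by one: `convergent a 0 = 1 / 0` and `convergent a 1 = 0 / 1`. -/
def convergent (a : ℕ → ℕ) : ℕ → ℕ × ℕ
  | 0 => (1, 0)
  | 1 => (0, 1)
  | t + 2 => a t • convergent a (t + 1) + convergent a t

/-- The denominator of the convergent `[0; a 0, …, a (t - 1)]`. -/
def convDen (a : ℕ → ℕ) (t : ℕ) : ℕ := (convergent a (t + 1)).2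

/-- `z` is the sequence of complete remainders of the continued fraction `[0; a 0, a 1, …]`. -/
def IsExpansion (a : ℕ → ℕ) (z : ℕ → ℝ) : Prop :=
  ∀ j, 0 < z j ∧ z j < 1 ∧ z j * (a j + z (j + 1)) = 1

theorem convDen_zero (a : ℕ → ℕ) : convDen a 0 = 1 := rfl

theorem convDen_one (a : ℕ → ℕ) : convDen a 1 = a 0 := by
  simp [convDen, convergent]

theorem convDen_add_two (a : ℕ → ℕ) (t : ℕ) :
    convDen a (t + 2) = a (t + 1) * convDen a (t + 1) + convDen a t := by
  rw [convDen, convergent]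
  simp [convDen]

theorem convergent_den_le_succ {a : ℕ → ℕ} (ha : ∀ j, 1 ≤ a j) (t : ℕ) :
    (convergent a t).2 ≤ (convergent a (t + 1)).2 := by
  cases t with
  | zero => simp [convergent]
  | succ t =>
    have h : (convergent a (t + 1 + 1)).2
        = a t * (convergent a (t + 1)).2 + (convergent a t).2 := by simp [convergent]
    have := Nat.mul_le_mul_right (convergent a (t + 1)).2 (ha t)
    omega

theorem convDen_le_succ {a : ℕ → ℕ} (ha : ∀ j, 1 ≤ a j) (t : ℕ) :
    convDen a t ≤ convDen a (t + 1) := convergent_den_le_succ ha (t + 1)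

theorem convDen_pos {a : ℕ → ℕ} (ha : ∀ j, 1 ≤ a j) (t : ℕ) : 0 < convDen a t := by
  induction t with
  | zero => simp [convDen_zero]
  | succ t ih => exact ih.trans_le (convDen_le_succ ha t)

theorem convDen_succ_le {a : ℕ → ℕ} (ha : ∀ j, 1 ≤ a j) {n : ℕ} (hn : ∀ j, a j ≤ n) (t : ℕ) :
    convDen a (t + 1) ≤ (n + 1) * convDen a t := by
  cases t with
  | zero =>
    rw [zero_add, convDen_one, convDen_zero]
    have := hn 0
    omega
  | succ t =>
    rw [convDen_add_two]
    have h1 := convDen_le_succ ha t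
    have h2 := Nat.mul_le_mul_right (convDen a (t + 1)) (hn (t + 1))
    linarith

theorem le_convDen {a : ℕ → ℕ} (ha : ∀ j, 1 ≤ a j) (t : ℕ) : t ≤ convDen a t := by
  have key : ∀ t, t ≤ convDen a t ∧ t + 1 ≤ convDen a (t + 1) := by
    intro t
    induction t with
    | zero => simpa [convDen_zero, convDen_one] using ha 0
    | succ t ih =>
      refine ⟨ih.2, ?_⟩
      rw [convDen_add_two]
      have h2 := Nat.mul_le_mul_right (convDen a (t + 1)) (ha (t + 1))
      have := convDen_pos ha t
      omega
  exact (key t).1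

/-! ### Continued fraction expansions -/

/-- The remainders in `(0, 1)` determine every floor, so the stream of integer and fractional parts
is `a`, `z` and never stops. Hence the default value `0` of `partialQuotient` does not occur, and `z
0` is irrational. -/
theorem partialQuotient_eq_of_isExpansion {a : ℕ → ℕ} {z : ℕ → ℝ} (h : IsExpansion a z) :
    (∀ j, partialQuotient (z 0) j = a j) ∧ Irrational (z 0) := by
  have hfl : ∀ j, ⌊(z j)⁻¹⌋ = (a j : ℤ) ∧ Int.fract (z j)⁻¹ = z (j + 1) := by
    intro j
    have hinv : (z j)⁻¹ = a j + z (j + 1) := inv_eq_of_mul_eq_one_right (h j).2.2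
    have hf : ⌊(z j)⁻¹⌋ = (a j : ℤ) := by
      rw [hinv, Int.floor_eq_iff]
      have := (h (j + 1)).1
      have := (h (j + 1)).2.1
      push_cast
      constructor <;> linarith
    refine ⟨hf, ?_⟩
    rw [Int.fract, hf, hinv]
    simp
  have hst : ∀ j, GenContFract.IntFractPair.stream (z 0) (j + 1) = some ⟨(a j : ℤ), z (j + 1)⟩ := by
    intro j
    induction j with
    | zero =>
      have h0 : Int.fract (z 0) = z 0 := Int.fract_eq_self.mpr ⟨(h 0).1.le, (h 0).2.1⟩
      rw [GenContFract.IntFractPair.stream_succ_of_some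
        (GenContFract.IntFractPair.stream_zero (z 0))]
      · simp only [GenContFract.IntFractPair.of, h0, (hfl 0).1, (hfl 0).2]
      · simpa [GenContFract.IntFractPair.of, h0] using (h 0).1.ne'
    | succ j ih =>
      rw [GenContFract.IntFractPair.stream_succ_of_some ih (h (j + 1)).1.ne']
      simp only [GenContFract.IntFractPair.of, (hfl (j + 1)).1, (hfl (j + 1)).2]
  constructor
  · intro j
    have := GenContFract.get?_of_eq_some_of_succ_get?_intFractPair_stream (hst j)
    rw [partialQuotient, GenContFract.partDen_eq_s_b this]
    simp
  · rintro ⟨q, hq⟩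
    obtain ⟨N, hN⟩ := (GenContFract.terminates_iff_rat (z 0)).mpr ⟨q, hq.symm⟩
    have hN := GenContFract.of_terminatedAt_n_iff_succ_nth_intFractPair_stream_eq_none.mp hN
    rw [hst] at hN
    exact absurd hN (by simp)

theorem exists_isExpansion_of_irrational {x : ℝ} (hx : x ∈ Set.Ioo (0 : ℝ) 1)
    (hirr : Irrational x) : ∃ a z, IsExpansion a z ∧ (∀ j, 1 ≤ a j) ∧ z 0 = x := by
  let z : ℕ → ℝ := fun j => (fun y : ℝ => Int.fract y⁻¹)^[j] x
  have hz : ∀ j, z (j + 1) = Int.fract (z j)⁻¹ := fun j =>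
    Function.iterate_succ_apply' _ _ _
  have key : ∀ j, Irrational (z j) ∧ 0 < z j ∧ z j < 1 := by
    intro j
    induction j with
    | zero => exact ⟨hirr, hx⟩
    | succ j ih =>
      have hi : Irrational (z (j + 1)) := by
        rw [hz, Int.fract]
        exact ih.1.inv.sub_intCast _
      refine ⟨hi, lt_of_le_of_ne ?_ (by simpa using (hi.ne_nat 0).symm), ?_⟩
      · rw [hz]; exact Int.fract_nonneg _
      · rw [hz]; exact Int.fract_lt_one _
  have hfl : ∀ j, (1 : ℤ) ≤ ⌊(z j)⁻¹⌋ := fun j => by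
    rw [Int.le_floor]
    simpa using (one_le_inv₀ (key j).2.1).mpr (key j).2.2.le
  refine ⟨fun j => ⌊(z j)⁻¹⌋.toNat, z, fun j => ⟨(key j).2.1, (key j).2.2, ?_⟩, fun j => ?_, rfl⟩
  · have h1 : ((⌊(z j)⁻¹⌋.toNat : ℕ) : ℝ) = (⌊(z j)⁻¹⌋ : ℝ) := by
      have := Int.toNat_of_nonneg (zero_le_one.trans (hfl j))
      exact_mod_cast congrArg (Int.cast (R := ℝ)) this
    rw [h1, hz, Int.floor_add_fract, mul_inv_cancel₀ (key j).2.1.ne']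
  · have := hfl j
    simp only
    omega

/-- Compactness of `[0, 1]^ℕ`: the first `N` equations define nested nonempty closed sets, whose
common point satisfies all of them. -/
theorem exists_isExpansion {a : ℕ → ℕ} (ha : ∀ j, 1 ≤ a j) : ∃ z, IsExpansion a z := by
  let K : Set (ℕ → ℝ) := Set.univ.pi fun _ => Set.Icc (0 : ℝ) 1
  let A : ℕ → Set (ℕ → ℝ) := fun N => K ∩ {z | ∀ j < N, z j * (a j + z (j + 1)) = 1}
  have hK : IsCompact K := isCompact_univ_pi fun _ => isCompact_Icc
  have hcl : ∀ N, IsClosed (A N) := by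
    intro N
    refine hK.isClosed.inter ?_
    simp only [Set.ofPred_forall]
    refine isClosed_iInter fun j => isClosed_iInter fun _ => isClosed_eq ?_ continuous_const
    fun_prop
  have hne : ∀ N, (A N).Nonempty := by
    intro N
    -- Finitely many equations are solved backwards from index `N`, each determining `z j` from `z
    -- (j + 1)`; `i` counts the equations already solved.
    have key : ∀ i, i ≤ N → ∃ z ∈ K, ∀ j, N - i ≤ j → j < N → z j * (a j + z (j + 1)) = 1 := by
      intro i
      induction i with
      | zero => exact fun _ => ⟨fun _ => 0, fun _ _ => by simp, fun j h1 h2 => by omega⟩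
      | succ i ih =>
        intro hi
        obtain ⟨z, hzK, hz⟩ := ih (by omega)
        have h0 : ∀ j, 0 ≤ z j := fun j => (hzK j trivial).1
        have hpos : 1 ≤ (a (N - (i + 1)) : ℝ) + z (N - i) := by
          have h1 : (1 : ℝ) ≤ a (N - (i + 1)) := by exact_mod_cast ha _
          linarith [h0 (N - i)]
        refine ⟨Function.update z (N - (i + 1)) (a (N - (i + 1)) + z (N - i))⁻¹, ?_, ?_⟩
        · intro j _
          by_cases hj : j = N - (i + 1)
          · subst hj
            simp only [Function.update_self]
            exact ⟨by positivity, inv_le_one_of_one_le₀ hpos⟩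
          · simp only [Function.update_of_ne hj]
            exact hzK j trivial
        · intro j h1 h2
          have hj1 : j + 1 ≠ N - (i + 1) := by omega
          rw [Function.update_of_ne hj1]
          by_cases hj : j = N - (i + 1)
          · subst hj
            rw [Function.update_self, show N - (i + 1) + 1 = N - i by omega]
            exact inv_mul_cancel₀ (by linarith)
          · rw [Function.update_of_ne hj]
            exact hz j (by omega) h2
    obtain ⟨z, hzK, hz⟩ := key N le_rfl
    exact ⟨z, hzK, fun j hj => hz j (by omega) hj⟩
  obtain ⟨z, hz⟩ := IsCompact.nonempty_iInter_of_sequence_nonempty_isCompact_isClosed A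
    (fun N => Set.inter_subset_inter_right _ fun z hz j hj => hz j (by omega)) hne
    (hK.inter_right (by
      simp only [Set.ofPred_forall]
      refine isClosed_iInter fun j => isClosed_iInter fun _ => isClosed_eq ?_ continuous_const
      fun_prop)) hcl
  rw [Set.mem_iInter] at hz
  have hzK : ∀ j, 0 ≤ z j := fun j => ((hz 0).1 j trivial).1
  have heq : ∀ j, z j * (a j + z (j + 1)) = 1 := fun j => (hz (j + 1)).2 j (by omega)
  have hpos : ∀ j, 0 < z j := fun j => lt_of_le_of_ne (hzK j) fun h0 => by
    have := heq j
    rw [← h0] at this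
    simp at this
  refine ⟨z, fun j => ⟨hpos j, ?_, heq j⟩⟩
  have h1 : (1 : ℝ) ≤ a j := by exact_mod_cast ha j
  nlinarith [heq j, hpos j, hpos (j + 1), mul_pos (hpos j) (hpos (j + 1))]

theorem IsExpansion.one_div_le {a : ℕ → ℕ} {z : ℕ → ℝ} (h : IsExpansion a z) {n : ℕ}
    (hn : ∀ j, a j ≤ n) (j : ℕ) : 1 / ((n : ℝ) + 1) ≤ z j := by
  have h1 : (a j : ℝ) ≤ n := by exact_mod_cast hn j
  have h2 := h j
  have h3 := h (j + 1)
  rw [div_le_iff₀ (by positivity), ← h2.2.2]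
  exact mul_le_mul_of_nonneg_left (by linarith) h2.1.le

theorem IsExpansion.mul_convergent {a : ℕ → ℕ} {z : ℕ → ℝ} (h : IsExpansion a z) (t : ℕ) :
    z 0 * ((convergent a (t + 1)).2 + z t * (convergent a t).2)
      = (convergent a (t + 1)).1 + z t * (convergent a t).1 := by
  induction t with
  | zero => simp [convergent]
  | succ t ih =>
    have h1 : ((convergent a (t + 1 + 1)).2 : ℝ)
        = a t * (convergent a (t + 1)).2 + (convergent a t).2 := by simp [convergent]
    have h2 : ((convergent a (t + 1 + 1)).1 : ℝ)
        = a t * (convergent a (t + 1)).1 + (convergent a t).1 := by simp [convergent]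
    rw [h1, h2]
    have h3 := (h t).2.2
    have h4 := (h t).1.ne'
    apply mul_left_cancel₀ h4
    linear_combination ih + (z 0 * (convergent a (t + 1)).2 - (convergent a (t + 1)).1) * h3

/-! ### The derivative of `?` and the size of the denominators -/

/-- Consecutive convergents are neighbours in the Stern-Brocot sequence of the level one less than
the sum of the partial quotients. -/
theorem exists_sternBrocot_eq_convergent {a : ℕ → ℕ} (ha : ∀ j, 1 ≤ a j) (t : ℕ) :
    ∃ m k, m + 1 = ∑ j ∈ Finset.range (t + 1), a j ∧ k + 1 ≤ 2 ^ m ∧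
      ((sternBrocot m k = convergent a (t + 1) ∧ sternBrocot m (k + 1) = convergent a (t + 2)) ∨
      (sternBrocot m k = convergent a (t + 2) ∧ sternBrocot m (k + 1) = convergent a (t + 1))) := by
  induction t with
  | zero =>
    have h0 := ha 0
    -- `0/1` and `1/(m + 1)` are the two leftmost points of level `m`, so the first partial quotient
    -- uses only `a 0 - 1` levels.
    refine ⟨a 0 - 1, 0, by simp; omega, Nat.one_le_two_pow, Or.inl ⟨?_, ?_⟩⟩
    · rw [sternBrocot_zero_right]; rfl
    · rw [sternBrocot_one_right]
      simp [convergent]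
      omega
  | succ t ih =>
    obtain ⟨m, k, hm, hk, h⟩ := ih
    have hpow : 2 ^ (m + a (t + 1)) = 2 ^ a (t + 1) * 2 ^ m := by rw [pow_add, mul_comm]
    -- Over `a (t + 1)` levels the newer convergent stays fixed and is added to the older one `a (t
    -- + 1)` times; the two sides alternate.
    rcases h with ⟨h1, h2⟩ | ⟨h1, h2⟩
    · obtain ⟨l, hl, hl'⟩ := sternBrocot_refine_left m (a (t + 1)) k
      refine ⟨m + a (t + 1), l, ?_, ?_, Or.inr ⟨?_, ?_⟩⟩
      · rw [Finset.sum_range_succ, ← hm]; ring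
      · rw [hl, hpow]; exact Nat.mul_le_mul_left _ hk
      · rw [hl', h1, h2, add_comm]; rfl
      · rw [hl, sternBrocot_refine, h2]
    · refine ⟨m + a (t + 1), 2 ^ a (t + 1) * k, ?_, ?_, Or.inl ⟨?_, ?_⟩⟩
      · rw [Finset.sum_range_succ, ← hm]; ring
      · rw [hpow]
        refine le_trans ?_ (Nat.mul_le_mul_left _ hk)
        have := Nat.one_le_two_pow (n := a (t + 1))
        rw [mul_add]
        omega
      · rw [sternBrocot_refine, h1]
      · rw [sternBrocot_refine_right, h1, h2]; rfl

theorem le_sub_of_weighted_mediant {p q p' q' z x : ℝ} (hq : 0 < q) (hqq : q ≤ q') (hz : 0 < z)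
    (hz1 : z < 1) (hdet : p' * q = p * q' + 1) (hx : x * (q' + z * q) = p' + z * p) :
    z / (2 * q' ^ 2) ≤ x - p / q ∧ z / (2 * q' ^ 2) ≤ p' / q' - x := by
  have hq' : 0 < q' := hq.trans_le hqq
  have hs : 0 < q' + z * q := by positivity
  have hs2 : q' + z * q ≤ 2 * q' := by nlinarith
  have hx' : x = (p' + z * p) / (q' + z * q) := by rw [← hx]; field_simp
  have e1 : x - p / q = 1 / (q * (q' + z * q)) := by
    rw [hx']; field_simp; linear_combination hdet
  have e2 : p' / q' - x = z / (q' * (q' + z * q)) := by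
    rw [hx']; field_simp; linear_combination z * hdet
  rw [e1, e2]
  have h3 : q' * (q' + z * q) ≤ 2 * q' ^ 2 := by nlinarith
  have h4 : q * (q' + z * q) ≤ 2 * q' ^ 2 := le_trans (by nlinarith) h3
  constructor
  · exact div_le_div₀ zero_le_one hz1.le (by positivity) h4
  · exact div_le_div_of_nonneg_left hz.le (by positivity) h3

/-- For each `t`, the number with continued fraction expansion `a` lies between two neighbours of
the Stern-Brocot sequence, at a controlled distance from both. -/
theorem IsExpansion.exists_sternBrocot_lt_lt {a : ℕ → ℕ} {z : ℕ → ℝ} (h : IsExpansion a z)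
    (ha : ∀ j, 1 ≤ a j) (t : ℕ) :
    ∃ m k, m + 1 = ∑ j ∈ Finset.range (t + 1), a j ∧ k + 1 ≤ 2 ^ m ∧
      sternBrocotPoint m (k + 1) - sternBrocotPoint m k
        = 1 / ((convDen a t : ℝ) * convDen a (t + 1)) ∧
      z (t + 1) / (2 * (convDen a (t + 1) : ℝ) ^ 2) ≤ z 0 - sternBrocotPoint m k ∧
      z (t + 1) / (2 * (convDen a (t + 1) : ℝ) ^ 2) ≤ sternBrocotPoint m (k + 1) - z 0 := by
  obtain ⟨m, k, hm, hk, hc⟩ := exists_sternBrocot_eq_convergent ha t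
  refine ⟨m, k, hm, hk, ?_⟩
  have hx := h.mul_convergent (t + 1)
  have hq : (0 : ℝ) < (convergent a (t + 1)).2 := by exact_mod_cast convDen_pos ha t
  have hqq : ((convergent a (t + 1)).2 : ℝ) ≤ (convergent a (t + 2)).2 := by
    exact_mod_cast convDen_le_succ ha t
  have hdet : ((sternBrocot m (k + 1)).1 : ℝ) * (sternBrocot m k).2
      = (sternBrocot m k).1 * (sternBrocot m (k + 1)).2 + 1 := by
    exact_mod_cast sternBrocot_det m k
  obtain ⟨hz, hz1, -⟩ := h (t + 1)
  rw [sternBrocotPoint_succ_sub]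
  unfold sternBrocotPoint convDen
  rcases hc with ⟨h1, h2⟩ | ⟨h1, h2⟩
  · rw [h1, h2] at hdet ⊢
    exact ⟨rfl, le_sub_of_weighted_mediant hq hqq hz hz1 hdet hx⟩
  · rw [h1, h2] at hdet ⊢
    refine ⟨by rw [mul_comm], ?_⟩
    -- Reflection `x ↦ -x` reduces the other orientation to the first.
    have := le_sub_of_weighted_mediant (p := -(convergent a (t + 1)).1)
      (p' := -(convergent a (t + 2)).1) (x := -z 0) hq hqq hz hz1
      (by linear_combination hdet) (by linear_combination -hx)
    rw [neg_div, neg_div] at this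
    constructor
    · linarith [this.2]
    · linarith [this.1]

theorem questionMark_sub_of_neighbours {m k : ℕ} (hk : k + 1 ≤ 2 ^ m) :
    questionMark (sternBrocotPoint m (k + 1)) - questionMark (sternBrocotPoint m k)
      = 1 / 2 ^ m := by
  rw [questionMark_sternBrocotPoint hk, questionMark_sternBrocotPoint (by omega)]
  push_cast
  ring

theorem sternBrocotPoint_nonneg (m k : ℕ) : 0 ≤ sternBrocotPoint m k := by
  unfold sternBrocotPoint
  positivity

theorem succ_le_convDen_mul {a : ℕ → ℕ} (ha : ∀ j, 1 ≤ a j) (t : ℕ) :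
    (t : ℝ) + 1 ≤ (convDen a t : ℝ) * convDen a (t + 1) := by
  have h1 := le_convDen ha (t + 1)
  have h2 := convDen_pos ha t
  have : t + 1 ≤ convDen a t * convDen a (t + 1) := by nlinarith
  exact_mod_cast this

theorem IsExpansion.lt_and_lt {a : ℕ → ℕ} {z : ℕ → ℝ} (h : IsExpansion a z)
    (ha : ∀ j, 1 ≤ a j) (t : ℕ) {l r : ℝ}
    (hl : z (t + 1) / (2 * (convDen a (t + 1) : ℝ) ^ 2) ≤ z 0 - l)
    (hr : z (t + 1) / (2 * (convDen a (t + 1) : ℝ) ^ 2) ≤ r - z 0) : l < z 0 ∧ z 0 < r := by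
  have h1 : (0 : ℝ) < convDen a (t + 1) := by exact_mod_cast convDen_pos ha (t + 1)
  have h2 := (h (t + 1)).1
  have : 0 < z (t + 1) / (2 * (convDen a (t + 1) : ℝ) ^ 2) := by positivity
  constructor <;> linarith

/-- If the derivative of the question mark function vanishes at a number with bounded partial
quotients, then the squares of the denominators are `O(2 ^ S_x(t))`. -/
theorem IsExpansion.convDen_sq_le {a : ℕ → ℕ} {z : ℕ → ℝ} (h : IsExpansion a z)
    (ha : ∀ j, 1 ≤ a j) {n : ℕ} (hn : ∀ j, a j ≤ n) (hd : HasDerivAt questionMark 0 (z 0)) :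
    ∃ C : ℝ, 0 < C ∧ ∀ t, (convDen a t : ℝ) ^ 2 ≤ C * 2 ^ (∑ j ∈ Finset.range t, a j) := by
  rw [hasDerivAt_iff_isLittleO, Asymptotics.isLittleO_iff] at hd
  obtain ⟨δ, hδ, hd⟩ := Metric.eventually_nhds_iff.mp (hd zero_lt_one)
  obtain ⟨T, hT⟩ := exists_nat_gt (1 / δ)
  have hlarge : ∀ t, T ≤ t →
      (convDen a t : ℝ) ^ 2 ≤ 2 ^ n * 2 ^ (∑ j ∈ Finset.range t, a j) := by
    intro t ht
    obtain ⟨m, k, hm, hk, hlen, hl, hr⟩ := h.exists_sternBrocot_lt_lt ha t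
    have hlr := h.lt_and_lt ha t hl hr
    have hq := succ_le_convDen_mul ha t
    have htT : (T : ℝ) ≤ t := by exact_mod_cast ht
    have hpos : (0 : ℝ) < (convDen a t : ℝ) * convDen a (t + 1) := lt_of_lt_of_le (by positivity) hq
    have hsmall : 1 / ((convDen a t : ℝ) * convDen a (t + 1)) < δ := by
      rw [div_lt_iff₀ hpos, ← div_lt_iff₀' hδ]
      linarith
    have h1 := hd (y := sternBrocotPoint m k) (by
      rw [Real.dist_eq, abs_sub_comm, abs_of_pos] <;> linarith)
    have h2 := hd (y := sternBrocotPoint m (k + 1)) (by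
      rw [Real.dist_eq, abs_of_pos] <;> linarith)
    simp only [smul_zero, sub_zero, one_mul, Real.norm_eq_abs] at h1 h2
    rw [abs_sub_comm (sternBrocotPoint m k), abs_of_pos (a := z 0 - _) (by linarith)] at h1
    rw [abs_of_pos (a := _ - z 0) (by linarith)] at h2
    have h3 := (neg_abs_le _).trans' (neg_le_neg h1)
    have h4 := (le_abs_self _).trans h2
    have h5 := questionMark_sub_of_neighbours hk
    -- The estimates on the two sides of `z 0` add up: the increment of `?` between the neighbours
    -- is at most their distance.
    have h6 : (1 : ℝ) / 2 ^ m ≤ 1 / ((convDen a t : ℝ) * convDen a (t + 1)) := by linarith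
    rw [div_le_div_iff₀ (by positivity) hpos, one_mul, one_mul] at h6
    have h7 : m ≤ n + ∑ j ∈ Finset.range t, a j := by
      rw [Finset.sum_range_succ] at hm
      have := hn t
      omega
    have h8 : (convDen a t : ℝ) ≤ convDen a (t + 1) := by exact_mod_cast convDen_le_succ ha t
    calc (convDen a t : ℝ) ^ 2 ≤ (convDen a t : ℝ) * convDen a (t + 1) := by
          rw [sq]; gcongr
      _ ≤ 2 ^ m := h6
      _ ≤ 2 ^ (n + ∑ j ∈ Finset.range t, a j) := pow_le_pow_right₀ one_le_two h7
      _ = _ := pow_add _ _ _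
  refine ⟨2 ^ n + (convDen a T : ℝ) ^ 2, by positivity, fun t => ?_⟩
  rw [add_mul]
  rcases le_total T t with ht | ht
  · have := hlarge t ht
    have : (0 : ℝ) ≤ (convDen a T : ℝ) ^ 2 * 2 ^ (∑ j ∈ Finset.range t, a j) := by positivity
    linarith
  · have h1 : (convDen a t : ℝ) ≤ convDen a T := by
      exact_mod_cast monotone_nat_of_le_succ (convDen_le_succ ha) ht
    have h2 : (1 : ℝ) ≤ 2 ^ (∑ j ∈ Finset.range t, a j) := one_le_pow₀ one_le_two
    have h3 : (convDen a t : ℝ) ^ 2 ≤ (convDen a T : ℝ) ^ 2 := by gcongr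
    have h4 : (0 : ℝ) ≤ 2 ^ n * 2 ^ (∑ j ∈ Finset.range t, a j) := by positivity
    nlinarith [sq_nonneg (convDen a T : ℝ)]

/-- If the partial quotients are bounded and the squares of the denominators are
`o(2 ^ S_x(t))`, then the derivative of the question mark function vanishes. -/
theorem IsExpansion.hasDerivAt_zero {a : ℕ → ℕ} {z : ℕ → ℝ} (h : IsExpansion a z)
    (ha : ∀ j, 1 ≤ a j) {n : ℕ} (hn : ∀ j, a j ≤ n)
    (ht : Tendsto (fun t => (convDen a t : ℝ) ^ 2 / 2 ^ (∑ j ∈ Finset.range t, a j)) atTop (𝓝 0)) :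
    HasDerivAt questionMark 0 (z 0) := by
  rw [hasDerivAt_iff_isLittleO, Asymptotics.isLittleO_iff]
  intro c hc
  have hK : (0 : ℝ) < 2 * ((n : ℝ) + 1) ^ 5 := by positivity
  obtain ⟨T, hT⟩ := eventually_atTop.mp (ht.eventually_lt_const (div_pos hc hK))
  choose m k hm hk hlen hl hr using h.exists_sternBrocot_lt_lt ha
  have hlr := fun t => h.lt_and_lt ha t (hl t) (hr t)
  filter_upwards [Ioo_mem_nhds (hlr T).1 (hlr T).2] with y hy
  simp only [smul_zero, sub_zero, Real.norm_eq_abs]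
  rcases eq_or_ne y (z 0) with rfl | hne
  · simp
  -- The last level at which `y` still lies in the interval around `z 0`; it exists because the
  -- lengths tend to `0`. Being inside at `t` bounds the increment of `?`, being outside at `t + 1`
  -- keeps `y` away from `z 0`.
  have hex : ∃ t, T ≤ t ∧ y ∈ Set.Ioo (sternBrocotPoint (m t) (k t))
      (sternBrocotPoint (m t) (k t + 1)) ∧
      y ∉ Set.Ioo (sternBrocotPoint (m (t + 1)) (k (t + 1)))
      (sternBrocotPoint (m (t + 1)) (k (t + 1) + 1)) := by
    by_contra! hcon
    have hall : ∀ i, y ∈ Set.Ioo (sternBrocotPoint (m (T + i)) (k (T + i)))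
        (sternBrocotPoint (m (T + i)) (k (T + i) + 1)) := by
      intro i
      induction i with
      | zero => exact hy
      | succ i ih => exact hcon (T + i) (by omega) ih
    obtain ⟨i, hi⟩ := exists_nat_gt (1 / |y - z 0|)
    have hyx : 0 < |y - z 0| := abs_pos.mpr (sub_ne_zero.mpr hne)
    have h1 := hall i
    have h2 : |y - z 0| < 1 / ((convDen a (T + i) : ℝ) * convDen a (T + i + 1)) := by
      rw [← hlen, abs_lt]
      constructor <;> linarith [h1.1, h1.2, (hlr (T + i)).1, (hlr (T + i)).2]
    have h3 := succ_le_convDen_mul ha (T + i)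
    have h4 : (0 : ℝ) < (convDen a (T + i) : ℝ) * convDen a (T + i + 1) :=
      lt_of_lt_of_le (by positivity) h3
    rw [lt_div_iff₀ h4] at h2
    rw [div_lt_iff₀ hyx] at hi
    push_cast at h3
    have : (0 : ℝ) ≤ T := by positivity
    nlinarith
  obtain ⟨t, htT, hyt, hyt'⟩ := hex
  have hq : (0 : ℝ) < convDen a t := by exact_mod_cast convDen_pos ha t
  have hq2 : (0 : ℝ) < convDen a (t + 1 + 1) := by exact_mod_cast convDen_pos ha (t + 1 + 1)
  have hd1 : |questionMark y - questionMark (z 0)| ≤ 1 / 2 ^ (∑ j ∈ Finset.range t, a j) := by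
    have h0 := sternBrocotPoint_nonneg (m t) (k t)
    have h1 := questionMark_mono h0 hyt.1.le
    have h2 := questionMark_mono (h0.trans hyt.1.le) hyt.2.le
    have h3 := questionMark_mono h0 (hlr t).1.le
    have h4 := questionMark_mono (h0.trans (hlr t).1.le) (hlr t).2.le
    have h5 := questionMark_sub_of_neighbours (hk t)
    have h6 : (1 : ℝ) / 2 ^ (m t) ≤ 1 / 2 ^ (∑ j ∈ Finset.range t, a j) := by
      apply one_div_le_one_div_of_le (by positivity)
      apply pow_le_pow_right₀ one_le_two
      have := hm t
      rw [Finset.sum_range_succ] at this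
      have := ha t
      omega
    rw [abs_le]
    constructor <;> linarith
  have hd2 : 1 / (2 * ((n : ℝ) + 1) ^ 5 * (convDen a t : ℝ) ^ 2) ≤ |y - z 0| := by
    have h1 : z (t + 1 + 1) / (2 * (convDen a (t + 1 + 1) : ℝ) ^ 2) ≤ |y - z 0| := by
      have e1 := hl (t + 1)
      have e2 := hr (t + 1)
      rcases le_or_gt y (sternBrocotPoint (m (t + 1)) (k (t + 1))) with h3 | h3
      · rw [abs_sub_comm]
        exact le_trans (by linarith) (le_abs_self _)
      · have h4 : sternBrocotPoint (m (t + 1)) (k (t + 1) + 1) ≤ y := by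
          by_contra! h4
          exact hyt' ⟨h3, h4⟩
        exact le_trans (by linarith) (le_abs_self _)
    refine le_trans ?_ h1
    have h2 := h.one_div_le hn (t + 1 + 1)
    -- The fifth power of `n + 1` in the distance: one factor from `z (t + 2)`, four from the square
    -- of this bound.
    have h3 : (convDen a (t + 1 + 1) : ℝ) ≤ ((n : ℝ) + 1) ^ 2 * convDen a t := by
      have e1 : (convDen a (t + 1 + 1) : ℝ) ≤ ((n : ℝ) + 1) * convDen a (t + 1) := by
        exact_mod_cast convDen_succ_le ha hn (t + 1)
      have e2 : (convDen a (t + 1) : ℝ) ≤ ((n : ℝ) + 1) * convDen a t := by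
        exact_mod_cast convDen_succ_le ha hn t
      nlinarith
    calc 1 / (2 * ((n : ℝ) + 1) ^ 5 * (convDen a t : ℝ) ^ 2)
        = (1 / ((n : ℝ) + 1)) / (2 * (((n : ℝ) + 1) ^ 2 * convDen a t) ^ 2) := by
          field_simp
      _ ≤ z (t + 1 + 1) / (2 * (convDen a (t + 1 + 1) : ℝ) ^ 2) := by
          apply div_le_div₀ (h (t + 1 + 1)).1.le h2 (by positivity)
          gcongr
  have hT' := hT t htT
  rw [div_lt_div_iff₀ (by positivity) hK] at hT'
  refine hd1.trans (le_trans ?_ (mul_le_mul_of_nonneg_left hd2 hc.le))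
  rw [mul_one_div, div_le_div_iff₀ (by positivity) (by positivity)]
  linarith

/-! ### Constants -/

theorem lam_one_sq : lam 1 ^ 2 = lam 1 + 1 := by
  have h : √((1 : ℝ) ^ 2 + 4) ^ 2 = 5 := by rw [Real.sq_sqrt (by norm_num)]; norm_num
  unfold lam
  push_cast
  linear_combination h / 4

theorem lam_one_bounds : 1.618 < lam 1 ∧ lam 1 < 1.6181 := by
  have h := lam_one_sq
  have h0 : 0 < lam 1 := by unfold lam; positivity
  constructor <;> nlinarith

theorem mu_sq (n : ℕ) : mu n ^ 2 = (n + 2) * mu n - 1 := by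
  have h : √((n : ℝ) ^ 2 + 4 * n) ^ 2 = (n : ℝ) ^ 2 + 4 * n := Real.sq_sqrt (by positivity)
  unfold mu
  linear_combination h / 4

theorem mu_bounds {n : ℕ} (hn : 5 ≤ n) : (n : ℝ) + 1.8 < mu n ∧ mu n < n + 2 := by
  have h := mu_sq n
  have hn' : (5 : ℝ) ≤ n := by exact_mod_cast hn
  have h0 : ((n : ℝ) + 2) / 2 ≤ mu n := by
    have := Real.sqrt_nonneg ((n : ℝ) ^ 2 + 4 * n)
    unfold mu
    linarith
  have h1 : mu n * (n + 2 - mu n) = 1 := by linear_combination -h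
  have h2 : mu n < n + 2 := by nlinarith
  refine ⟨?_, h2⟩
  by_contra! hcon
  nlinarith

/-- The slope of the affine function of `a` whose exponential is `λ₁` at `a = 1` and `μ_n / λ₁` at
`a = n`. -/
noncomputable def slope (n : ℕ) : ℝ := (Real.log (mu n) - 2 * Real.log (lam 1)) / ((n : ℝ) - 1)

/-- The constant term of the affine function of `a` whose exponential is `λ₁` at `a = 1` and
`μ_n / λ₁` at `a = n`. -/
noncomputable def offset (n : ℕ) : ℝ := Real.log (lam 1) - slope n

theorem slope_add_offset (n : ℕ) : slope n + offset n = Real.log (lam 1) := by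
  unfold offset; ring

theorem slope_mul_sub_one {n : ℕ} (hn : 5 ≤ n) :
    slope n * ((n : ℝ) - 1) = Real.log (mu n) - 2 * Real.log (lam 1) := by
  have hn' : (5 : ℝ) ≤ n := by exact_mod_cast hn
  exact div_mul_cancel₀ _ (by linarith)

theorem slope_mul_add_offset {n : ℕ} (hn : 5 ≤ n) :
    slope n * n + offset n = Real.log (mu n) - Real.log (lam 1) := by
  have := slope_mul_sub_one hn
  unfold offset
  linarith

theorem exp_slope_one (n : ℕ) : Real.exp (slope n * (1 : ℕ) + offset n) = lam 1 := by
  rw [Nat.cast_one, mul_one, slope_add_offset, Real.exp_log (by linarith [lam_one_bounds.1])]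

theorem exp_slope_self {n : ℕ} (hn : 5 ≤ n) :
    Real.exp (slope n * n + offset n) = mu n / lam 1 := by
  have hn' : (5 : ℝ) ≤ n := by exact_mod_cast hn
  rw [slope_mul_add_offset hn, Real.exp_sub, Real.exp_log (by linarith [(mu_bounds hn).1]),
    Real.exp_log (by linarith [lam_one_bounds.1])]

theorem log_sqrt_two : Real.log (√2) = Real.log 2 / 2 := by
  rw [Real.sqrt_eq_rpow, Real.log_rpow (by norm_num)]; ring

/-- The gain of `log (2 ^ (S / 2))` over `log μ_n` along a block `n, 1`. -/
theorem one_div_le_block_gain {n : ℕ} (hn : 5 ≤ n) :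
    1 / ((n : ℝ) + 4) ≤ (n + 1) * Real.log (√2) - Real.log (mu n) := by
  -- This uses `n ≥ 5`, with equality at `n = 5`.
  have hpow : (n + 3) ^ 2 ≤ 2 ^ (n + 1) := by
    induction n, hn using Nat.le_induction with
    | base => norm_num
    | succ n hn ih => rw [pow_succ 2]; nlinarith
  have h1 : 2 * Real.log ((n : ℝ) + 3) ≤ (n + 1) * Real.log 2 := by
    have : Real.log (((n : ℝ) + 3) ^ 2) ≤ Real.log (2 ^ (n + 1)) :=
      Real.log_le_log (by positivity) (by exact_mod_cast hpow)
    rw [Real.log_pow, Real.log_pow] at this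
    push_cast at this
    exact this
  have hmu := mu_bounds hn
  have h2 : Real.log (mu n) ≤ Real.log ((n : ℝ) + 2) :=
    Real.log_le_log (by have : (0 : ℝ) ≤ n := by positivity
                        linarith) hmu.2.le
  have h3 := Real.one_sub_inv_le_log_of_pos (x := ((n : ℝ) + 3) / (n + 2)) (by positivity)
  rw [Real.log_div (by positivity) (by positivity), inv_div] at h3
  have h4 : 1 / ((n : ℝ) + 4) ≤ 1 - (n + 2) / (n + 3) := by
    rw [one_sub_div (by positivity), div_le_div_iff₀ (by positivity) (by positivity)]
    linarith
  rw [log_sqrt_two]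
  linarith

theorem log_lam_one_sub_bound : 0.118 ≤ Real.log (lam 1) - Real.log (√2) := by
  have h := lam_one_bounds
  have h1 := Real.one_sub_inv_le_log_of_pos (x := lam 1 ^ 2 / 2) (by nlinarith)
  rw [Real.log_div (by nlinarith) (by norm_num), Real.log_pow, inv_div] at h1
  have h2 : 2 / lam 1 ^ 2 ≤ 0.764 := by
    rw [div_le_iff₀ (by nlinarith), lam_one_sq]
    linarith
  rw [log_sqrt_two]
  push_cast at h1
  linarith

/-- The factor by which `S_x(t) - κ_n t` has to be multiplied to become
`log (2 ^ (S_x(t) / 2)) - slope n * S_x(t) - offset n * t`. -/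
noncomputable def excessScale (n : ℕ) : ℝ := Real.log (√2) - slope n

theorem excessScale_mul_sub_one {n : ℕ} (hn : 5 ≤ n) :
    excessScale n * ((n : ℝ) - 1) = ((n + 1) * Real.log (√2) - Real.log (mu n))
      + 2 * (Real.log (lam 1) - Real.log (√2)) := by
  have := slope_mul_sub_one hn
  unfold excessScale
  linarith

theorem excessScale_pos {n : ℕ} (hn : 5 ≤ n) : 0 < excessScale n := by
  have hn' : (5 : ℝ) ≤ n := by exact_mod_cast hn
  have h1 := one_div_le_block_gain hn
  have h2 := log_lam_one_sub_bound
  have h3 := excessScale_mul_sub_one hn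
  have h4 : 0 < 1 / ((n : ℝ) + 4) := by positivity
  have : 0 < excessScale n * ((n : ℝ) - 1) := by rw [h3]; linarith
  exact pos_of_mul_pos_left this (by linarith)

theorem excessScale_le_one {n : ℕ} (hn : 5 ≤ n) : excessScale n ≤ 1 := by
  have hn' : (5 : ℝ) ≤ n := by exact_mod_cast hn
  have hl := lam_one_bounds
  have hm := mu_bounds hn
  have h1 : 0 ≤ slope n := by
    refine div_nonneg ?_ (by linarith)
    have : Real.log (lam 1 ^ 2) ≤ Real.log (mu n) :=
      Real.log_le_log (by nlinarith) (by rw [lam_one_sq]; linarith)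
    rw [Real.log_pow] at this
    push_cast at this
    linarith
  have h2 := Real.log_two_lt_d9
  unfold excessScale
  rw [log_sqrt_two]
  linarith

/-- The origin of `κ_n`: it is the ratio `S / t` at which the product of the weights equals `2 ^ (S
/ 2)`. -/
theorem excessScale_mul_kappa {n : ℕ} (hn : 5 ≤ n) : excessScale n * kappa n = offset n := by
  have hn' : (5 : ℝ) ≤ n := by exact_mod_cast hn
  have h0 := excessScale_pos hn
  have h1 := slope_mul_sub_one hn
  have hne : (n : ℝ) - 1 ≠ 0 := by linarith
  have h2 : ((n : ℝ) - 1) * Real.log (√2) - Real.log (mu n) + 2 * Real.log (lam 1)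
      = excessScale n * (n - 1) := by unfold excessScale; linarith
  have h3 : ((n : ℝ) + 1) * Real.log (lam 1) - Real.log (mu n) = offset n * (n - 1) := by
    unfold offset; linarith
  unfold kappa
  rw [h2, h3]
  field_simp

/-! ### The antinorm -/

/-- The linear form with coefficients proportional to `[n; 1, n, 1, …]` and `1`. -/
noncomputable def formN (n : ℕ) (x y : ℝ) : ℝ := (mu n - 1) * x + y

/-- The linear form with coefficients proportional to `[1; n, 1, n, …]` and `1`. -/
noncomputable def formOne (n : ℕ) (x y : ℝ) : ℝ := (mu n * x + (mu n - 1) * y) / lam 1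

/-- A concave, positively homogeneous function of `(q_t, q_{t-1})`, which grows at least as fast as
the weights `exp (slope n * a + offset n)` prescribe. -/
noncomputable def antinorm (n : ℕ) (x y : ℝ) : ℝ := min (formN n x y) (formOne n x y)

theorem lam_one_pos : 0 < lam 1 := by linarith [lam_one_bounds.1]

/-- Together with `formOne_self`: the letters `1` and `n` interchange the two forms exactly, with
factors `λ₁` and `μ_n / λ₁`. Hence the alternating sequence cannot beat the weights. -/
theorem formN_one (n : ℕ) (x y : ℝ) : formN n (x + y) x = lam 1 * formOne n x y := by
  have := lam_one_pos
  unfold formN formOne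
  field_simp
  ring

theorem formOne_one (n : ℕ) (x y : ℝ) :
    formOne n (x + y) x = formOne n x y + formN n x y / lam 1 := by
  have := lam_one_pos
  unfold formN formOne
  field_simp
  ring

theorem formOne_self (n : ℕ) (x y : ℝ) :
    formOne n (n * x + y) x = mu n / lam 1 * formN n x y := by
  have := lam_one_pos
  unfold formN formOne
  field_simp
  linear_combination -x * mu_sq n

theorem formN_self {n : ℕ} (hn : 5 ≤ n) {x y : ℝ} (hx : 0 ≤ x) (hy : 0 ≤ y) :
    1.1 * (mu n / lam 1) * formN n x y ≤ formN n (n * x + y) x := by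
  have hn' : (5 : ℝ) ≤ n := by exact_mod_cast hn
  have hl := lam_one_bounds
  have hm := mu_bounds hn
  have h1 : mu n / lam 1 ≤ (n + 2) / 1.618 :=
    div_le_div₀ (by linarith) hm.2.le (by norm_num) hl.1.le
  have h2 : mu n / lam 1 ≤ mu n / 1.618 :=
    div_le_div_of_nonneg_left (by linarith) (by norm_num) hl.1.le
  have h3 : 1.1 * (mu n / lam 1) ≤ n := by
    rw [le_div_iff₀ (by norm_num)] at h1; linarith
  have h4 : 1.1 * (mu n / lam 1) ≤ mu n - 1 := by
    rw [le_div_iff₀ (by norm_num)] at h2; linarith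
  unfold formN
  have h5 : 1.1 * (mu n / lam 1) * ((mu n - 1) * x) ≤ n * ((mu n - 1) * x) :=
    mul_le_mul_of_nonneg_right h3 (mul_nonneg (by linarith) hx)
  have h6 : 1.1 * (mu n / lam 1) * y ≤ (mu n - 1) * y := mul_le_mul_of_nonneg_right h4 hy
  linarith

/-- The hypothesis `n * y ≤ x` describes the pairs of denominators just after a letter `n`. There
`formOne` is the smaller form by a definite factor, which is what makes a following `n` or `1, 1`
wasteful. -/
theorem formOne_le_formN {n : ℕ} (hn : 5 ≤ n) {x y : ℝ} (hy : 0 ≤ y) (hxy : n * y ≤ x) :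
    1.1 * formOne n x y ≤ formN n x y := by
  have hn' : (5 : ℝ) ≤ n := by exact_mod_cast hn
  have hl := lam_one_bounds
  have hm := mu_bounds hn
  unfold formN formOne
  rw [← mul_div_assoc, div_le_iff₀ lam_one_pos]
  have h1 : 5 * y ≤ x := le_trans (by gcongr) hxy
  have hx : 0 ≤ x := by linarith
  have h2 : 1.1 * mu n + 1.8 ≤ (mu n - 1) * lam 1 := by nlinarith
  have h3 := mul_le_mul_of_nonneg_right h2 hx
  have h4 : 1.1 * (mu n - 1) * y ≤ 1.8 * x + lam 1 * y := by
    have : (mu n - 1) * y ≤ (n + 1) * y := mul_le_mul_of_nonneg_right (by linarith) hy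
    nlinarith
  linarith

theorem formN_nonneg {n : ℕ} (hn : 5 ≤ n) {x y : ℝ} (hx : 0 ≤ x) (hy : 0 ≤ y) :
    0 ≤ formN n x y := by
  have : (0 : ℝ) ≤ n := by positivity
  have := mul_nonneg (by linarith [(mu_bounds hn).1] : 0 ≤ mu n - 1) hx
  unfold formN
  linarith

theorem le_antinorm {n : ℕ} (hn : 5 ≤ n) {x y : ℝ} (hx : 0 ≤ x) (hy : 0 ≤ y) :
    x ≤ antinorm n x y := by
  have hn' : (5 : ℝ) ≤ n := by exact_mod_cast hn
  have hl := lam_one_bounds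
  have hm := mu_bounds hn
  unfold antinorm formN formOne
  refine le_min (by nlinarith) ?_
  rw [le_div_iff₀ lam_one_pos]
  nlinarith

theorem antinorm_nonneg {n : ℕ} (hn : 5 ≤ n) {x y : ℝ} (hx : 0 ≤ x) (hy : 0 ≤ y) :
    0 ≤ antinorm n x y := hx.trans (le_antinorm hn hx hy)

theorem antinorm_one (n : ℕ) (x y : ℝ) : lam 1 * antinorm n x y ≤ antinorm n (x + y) x := by
  have h0 := lam_one_pos
  have h1 : antinorm n x y ≤ formN n x y := min_le_left _ _
  have h2 : antinorm n x y ≤ formOne n x y := min_le_right _ _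
  refine le_min ?_ ?_
  · rw [formN_one]; gcongr
  · rw [formOne_one]
    have h3 : antinorm n x y / lam 1 ≤ formN n x y / lam 1 := by gcongr
    have h4 : lam 1 * antinorm n x y = antinorm n x y + antinorm n x y / lam 1 := by
      field_simp
      linear_combination antinorm n x y * lam_one_sq
    linarith

theorem antinorm_self {n : ℕ} (hn : 5 ≤ n) {x y : ℝ} (hx : 0 ≤ x) (hy : 0 ≤ y) :
    mu n / lam 1 * antinorm n x y ≤ antinorm n (n * x + y) x := by
  have h0 := lam_one_pos
  have h1 : antinorm n x y ≤ formN n x y := min_le_left _ _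
  have hn' : (5 : ℝ) ≤ n := by exact_mod_cast hn
  have hm := mu_bounds hn
  have h5 : 0 ≤ mu n / lam 1 := div_nonneg (by linarith) h0.le
  have h6 := mul_le_mul_of_nonneg_left h1 h5
  refine le_min ?_ ?_
  · have := formN_self hn hx hy
    have := mul_nonneg h5 (formN_nonneg hn hx hy)
    linarith
  · rwa [formOne_self]

/-- After a partial quotient `n`, a second `n` is wasteful. -/
theorem antinorm_self_self {n : ℕ} (hn : 5 ≤ n) {x y : ℝ} (hy : 0 ≤ y) (hxy : n * y ≤ x) :
    1.01 * (mu n / lam 1) * antinorm n x y ≤ antinorm n (n * x + y) x := by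
  have h0 := lam_one_pos
  have hn' : (5 : ℝ) ≤ n := by exact_mod_cast hn
  have hm := mu_bounds hn
  have hx : 0 ≤ x := le_trans (by positivity) hxy
  have h1 : antinorm n x y ≤ formN n x y := min_le_left _ _
  have h2 : antinorm n x y ≤ formOne n x y := min_le_right _ _
  have hN := antinorm_nonneg hn hx hy
  have h5 : 0 ≤ mu n / lam 1 := div_nonneg (by linarith) h0.le
  have h6 : 1.1 * antinorm n x y ≤ formN n x y := by
    linarith [formOne_le_formN hn hy hxy]
  have h7 := mul_le_mul_of_nonneg_left h6 h5
  have h8 := mul_le_mul_of_nonneg_left h1 h5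
  have h9 := mul_nonneg h5 hN
  refine le_min ?_ ?_
  · have := formN_self hn hx hy
    linarith
  · rw [formOne_self]
    linarith

/-- After a partial quotient `n`, two partial quotients `1` in a row are wasteful. -/
theorem antinorm_one_one {n : ℕ} (hn : 5 ≤ n) {x y : ℝ} (hy : 0 ≤ y) (hxy : n * y ≤ x) :
    1.01 * lam 1 * lam 1 * antinorm n x y ≤ antinorm n (x + y + x) (x + y) := by
  have h0 := lam_one_pos
  have hl := lam_one_bounds
  have hn' : (5 : ℝ) ≤ n := by exact_mod_cast hn
  have hx : 0 ≤ x := le_trans (by positivity) hxy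
  have h2 : antinorm n x y ≤ formOne n x y := min_le_right _ _
  have hN := antinorm_nonneg hn hx hy
  have h6 := formOne_le_formN hn hy hxy
  have h7 : 1.01 * lam 1 * lam 1 * antinorm n x y ≤ 2.645 * formOne n x y := by
    have : 1.01 * lam 1 * lam 1 = 1.01 * (lam 1 + 1) := by rw [← lam_one_sq]; ring
    rw [this]
    nlinarith
  refine le_min ?_ ?_
  · rw [formN_one, formOne_one, mul_add, mul_div_cancel₀ _ h0.ne']
    nlinarith
  · rw [formOne_one, formOne_one, formN_one, mul_div_cancel_left₀ _ h0.ne']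
    have : 0.67 * formOne n x y ≤ formN n x y / lam 1 := by
      rw [le_div_iff₀ h0]
      nlinarith
    linarith

/-- Quantitative convexity: Bernoulli's inequality on the half of `[0, 1]` containing `s` leaves
exactly the stated multiple of `(r - 1) ^ 2`. -/
theorem rpow_add_min_mul_le {s r : ℝ} (hs0 : 0 ≤ s) (hs1 : s ≤ 1) (hr : 0 < r) :
    r ^ (2 * s) + min s (1 - s) * (r - 1) ^ 2 ≤ 1 - s + s * r ^ 2 := by
  rcases le_total s (1 / 2) with h | h
  · rw [min_eq_left (by linarith)]
    have := rpow_one_add_le_one_add_mul_self (s := r - 1) (p := 2 * s) (by linarith)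
      (by linarith) (by linarith)
    rw [add_sub_cancel] at this
    nlinarith
  · rw [min_eq_right (by linarith)]
    have h1 := rpow_one_add_le_one_add_mul_self (s := r - 1) (p := 2 * s - 1) (by linarith)
      (by linarith) (by linarith)
    rw [add_sub_cancel] at h1
    have h2 : r ^ (2 * s) = r * r ^ (2 * s - 1) := by
      rw [Real.rpow_sub_one hr.ne']; field_simp
    rw [h2]
    nlinarith

/-- The weight of a partial quotient strictly between `1` and `n` is smaller than the value of the
chord. -/
theorem exp_slope_lt_chord {n : ℕ} (hn : 5 ≤ n) {a : ℕ} (h1 : 1 < a) (han : a < n) :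
    (1 + 1 / (4 * ((n : ℝ) + 2) ^ 2)) * Real.exp (slope n * a + offset n)
      ≤ (1 - ((a : ℝ) - 1) / (n - 1)) * lam 1 + ((a : ℝ) - 1) / (n - 1) * (mu n / lam 1) := by
  have hn' : (5 : ℝ) ≤ n := by exact_mod_cast hn
  have hl := lam_one_bounds
  have hm := mu_bounds hn
  have h0 := lam_one_pos
  have hmu0 : 0 < mu n := by linarith
  have ha1 : (2 : ℝ) ≤ a := by exact_mod_cast h1
  have ha2 : (a : ℝ) + 1 ≤ n := by exact_mod_cast han
  set s : ℝ := ((a : ℝ) - 1) / (n - 1) with hs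
  set R : ℝ := mu n / lam 1 ^ 2 with hR
  have hl2 : 2.618 < lam 1 ^ 2 ∧ lam 1 ^ 2 < 2.6181 := by
    rw [lam_one_sq]; constructor <;> linarith
  have hRpos : 0 < R := by positivity
  have hRlow : 2.56 ≤ R := by
    rw [hR, le_div_iff₀ (by positivity)]; linarith
  have hRup : R ≤ (n + 2) / 2 := by
    rw [hR, div_le_iff₀ (by positivity)]; nlinarith
  have hsl : 1 / ((n : ℝ) - 1) ≤ min s (1 - s) := by
    refine le_min ?_ ?_
    · rw [hs]; apply div_le_div_of_nonneg_right <;> linarith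
    · rw [hs, one_sub_div (by linarith)]; apply div_le_div_of_nonneg_right <;> linarith
  have hs0 : 0 ≤ s := div_nonneg (by linarith) (by linarith)
  have hs1 : s ≤ 1 := by rw [hs, div_le_one (by linarith)]; linarith
  -- `R` is the ratio of the weights of `n` and `1`, so the weight of `a` interpolates them
  -- geometrically.
  have hexp : Real.exp (slope n * a + offset n) = lam 1 * R ^ s := by
    have e1 : slope n * a + offset n = Real.log (lam 1) + Real.log R * s := by
      have hne : (n : ℝ) - 1 ≠ 0 := by linarith
      rw [hR, Real.log_div hmu0.ne' (by positivity), Real.log_pow, hs]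
      unfold offset slope
      push_cast
      field_simp
      ring
    rw [e1, Real.exp_add, Real.exp_log h0, Real.rpow_def_of_pos hRpos]
  have hr : √R ^ 2 = R := Real.sq_sqrt hRpos.le
  have hr1 : 1.6 ≤ √R := Real.le_sqrt_of_sq_le (by norm_num; linarith)
  have hpow : √R ^ (2 * s) = R ^ s := by
    rw [Real.rpow_mul (Real.sqrt_nonneg R), Real.rpow_two, hr]
  have key := rpow_add_min_mul_le hs0 hs1 (Real.sqrt_pos.mpr hRpos)
  rw [hpow, hr] at key
  have hRs : R ^ s ≤ R := by
    simpa using Real.rpow_le_rpow_of_exponent_le (by linarith : 1 ≤ R) hs1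
  have hgain : 1 / (4 * ((n : ℝ) + 2) ^ 2) * R ^ s ≤ min s (1 - s) * (√R - 1) ^ 2 := by
    calc 1 / (4 * ((n : ℝ) + 2) ^ 2) * R ^ s
        ≤ 1 / (4 * ((n : ℝ) + 2) ^ 2) * ((n + 2) / 2) := by gcongr; linarith
      _ = 1 / ((n : ℝ) + 2) * 0.125 := by field_simp; norm_num
      _ ≤ 1 / ((n : ℝ) - 1) * (√R - 1) ^ 2 := by
          apply mul_le_mul
          · apply one_div_le_one_div_of_le <;> linarith
          · nlinarith
          · norm_num
          · exact div_nonneg zero_le_one (by linarith)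
      _ ≤ _ := by gcongr
  have hfin : (1 + 1 / (4 * ((n : ℝ) + 2) ^ 2)) * R ^ s ≤ 1 - s + s * R := by linarith
  have hmuR : mu n / lam 1 = lam 1 * R := by rw [hR]; field_simp
  rw [hexp, hmuR]
  nlinarith [mul_le_mul_of_nonneg_left hfin h0.le]

theorem formN_affine (n : ℕ) (s a x y : ℝ) (hs : a = 1 - s + s * n) :
    formN n (a * x + y) x = (1 - s) * formN n (x + y) x + s * formN n (n * x + y) x := by
  subst hs; unfold formN; ring

theorem formOne_affine (n : ℕ) (s a x y : ℝ) (hs : a = 1 - s + s * n) :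
    formOne n (a * x + y) x = (1 - s) * formOne n (x + y) x + s * formOne n (n * x + y) x := by
  subst hs; unfold formOne; ring

/-- Both forms are affine in `a`, so their minimum is concave and lies above the chord from `1` to
`n`; the weight is strictly convex and lies below it. -/
theorem antinorm_middle {n : ℕ} (hn : 5 ≤ n) {a : ℕ} (h1 : 1 < a) (han : a < n) {x y : ℝ}
    (hx : 0 ≤ x) (hy : 0 ≤ y) :
    (1 + 1 / (4 * ((n : ℝ) + 2) ^ 2)) * Real.exp (slope n * a + offset n) * antinorm n x y
      ≤ antinorm n (a * x + y) x := by
  have hn' : (5 : ℝ) ≤ n := by exact_mod_cast hn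
  have ha1 : (2 : ℝ) ≤ a := by exact_mod_cast h1
  have ha2 : (a : ℝ) + 1 ≤ n := by exact_mod_cast han
  set s : ℝ := ((a : ℝ) - 1) / (n - 1) with hs
  have hs0 : 0 ≤ s := div_nonneg (by linarith) (by linarith)
  have hs1 : 0 ≤ 1 - s := by
    rw [sub_nonneg, hs, div_le_one (by linarith)]; linarith
  have has : (a : ℝ) = 1 - s + s * n := by
    have hne : (n : ℝ) - 1 ≠ 0 := by linarith
    rw [hs]; field_simp; ring
  have hN := antinorm_nonneg hn hx hy
  have e1 := mul_le_mul_of_nonneg_left (antinorm_one n x y) hs1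
  have e2 := mul_le_mul_of_nonneg_left (antinorm_self hn hx hy) hs0
  have e3 := mul_le_mul_of_nonneg_right (exp_slope_lt_chord hn h1 han) hN
  have e4 : (1 - s) * antinorm n (x + y) x + s * antinorm n (n * x + y) x
      ≤ antinorm n (a * x + y) x := by
    refine le_min ?_ ?_
    · rw [formN_affine n s a x y has]
      exact add_le_add (mul_le_mul_of_nonneg_left (min_le_left _ _) hs1)
        (mul_le_mul_of_nonneg_left (min_le_left _ _) hs0)
    · rw [formOne_affine n s a x y has]
      exact add_le_add (mul_le_mul_of_nonneg_left (min_le_right _ _) hs1)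
        (mul_le_mul_of_nonneg_left (min_le_right _ _) hs0)
  linarith

theorem antinorm_step {n : ℕ} (hn : 5 ≤ n) {a : ℕ} (h1 : 1 ≤ a) (han : a ≤ n) {x y : ℝ}
    (hx : 0 ≤ x) (hy : 0 ≤ y) :
    Real.exp (slope n * a + offset n) * antinorm n x y ≤ antinorm n (a * x + y) x := by
  rcases h1.eq_or_lt with rfl | h1
  · rw [exp_slope_one, Nat.cast_one, one_mul]
    exact antinorm_one n x y
  rcases han.eq_or_lt with rfl | han
  · rw [exp_slope_self hn]
    exact antinorm_self hn hx hy
  refine le_trans ?_ (antinorm_middle hn h1 han hx hy)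
  have h2 : (1 : ℝ) ≤ 1 + 1 / (4 * ((n : ℝ) + 2) ^ 2) := by
    have : 0 ≤ 1 / (4 * ((n : ℝ) + 2) ^ 2) := by positivity
    linarith
  have h3 := mul_nonneg (Real.exp_pos (slope n * a + offset n)).le (antinorm_nonneg hn hx hy)
  nlinarith

/-! ### Growth of denominators -/

/-- `S_x(t)` as a real number, for the sequence `a` of partial quotients. -/
def natSum (a : ℕ → ℕ) (t : ℕ) : ℝ := ∑ j ∈ Finset.range t, (a j : ℝ)

/-- The quantity `log (2 ^ (S(t) / 2)) - slope n * S(t) - offset n * t`. -/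
noncomputable def excess (n : ℕ) (a : ℕ → ℕ) (t : ℕ) : ℝ :=
  excessScale n * natSum a t - offset n * t

/-- The logarithm of the antinorm of `(q_t, q_{t-1})`, relative to the weights. -/
noncomputable def relativeGrowth (n : ℕ) (a : ℕ → ℕ) (t : ℕ) : ℝ :=
  Real.log (antinorm n (convergent a (t + 1)).2 (convergent a t).2)
    - (slope n * natSum a t + offset n * t)

theorem natSum_succ (a : ℕ → ℕ) (t : ℕ) : natSum a (t + 1) = natSum a t + a t :=
  Finset.sum_range_succ _ _

theorem natSum_eq_cast (a : ℕ → ℕ) (t : ℕ) :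
    natSum a t = ((∑ j ∈ Finset.range t, a j : ℕ) : ℝ) := by
  unfold natSum; push_cast; rfl

theorem excess_zero (n : ℕ) (a : ℕ → ℕ) : excess n a 0 = 0 := by simp [excess, natSum]

theorem excess_eq {n : ℕ} (hn : 5 ≤ n) (a : ℕ → ℕ) (t : ℕ) :
    excess n a t = excessScale n * (natSum a t - kappa n * t) := by
  rw [excess, ← excessScale_mul_kappa hn]
  ring

theorem excess_succ_of_one {n : ℕ} {a : ℕ → ℕ} {t : ℕ} (h : a t = 1) :
    excess n a (t + 1) = excess n a t - (Real.log (lam 1) - Real.log (√2)) := by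
  have := slope_add_offset n
  unfold excess
  rw [natSum_succ, h, excessScale]
  push_cast
  linarith

theorem excess_succ_of_self {n : ℕ} (hn : 5 ≤ n) {a : ℕ → ℕ} {t : ℕ} (h : a t = n) :
    excess n a (t + 1) = excess n a t
      + (n * Real.log (√2) - (Real.log (mu n) - Real.log (lam 1))) := by
  have := slope_mul_add_offset hn
  unfold excess
  rw [natSum_succ, h, excessScale]
  push_cast
  linarith

theorem convergent_den_succ (a : ℕ → ℕ) (t : ℕ) :
    ((convergent a (t + 1 + 1)).2 : ℝ) = a t * (convergent a (t + 1)).2 + (convergent a t).2 := by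
  simp [convergent]

/-- A window in which the excess stays in a short interval contains a pattern different from those
of `1, 1, …, 1, n, 1, n, 1, …`. -/
theorem exists_wasteful_pattern {n : ℕ} {a : ℕ → ℕ} {ψ : ℕ → ℝ} {g b c : ℝ}
    (h1 : ∀ i, a i = 1 → ψ (i + 1) ≤ ψ i - g)
    (hn : ∀ i, a i = n → a (i + 1) = 1 → ψ i + g ≤ ψ (i + 2))
    (u K : ℕ) (hK : c - b < K * g)
    (hψ : ∀ i, u ≤ i → i ≤ u + (3 * K + 3) → b ≤ ψ i ∧ ψ i ≤ c) :
    ∃ i, u ≤ i ∧ i + 3 ≤ u + (3 * K + 3) ∧ ((a i ≠ 1 ∧ a i ≠ n) ∨ (a i = n ∧ a (i + 1) = n) ∨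
      (a i = n ∧ a (i + 1) = 1 ∧ a (i + 2) = 1)) := by
  by_contra! hcon
  have hone_or : ∀ i, u ≤ i → i ≤ u + 3 * K → a i ≠ 1 → a i = n := fun i h2 h3 =>
    (hcon i h2 (by omega)).1
  have hnn : ∀ i, u ≤ i → i + 2 ≤ u + 3 * K → a i = n → a (i + 1) = 1 ∧ a (i + 2) = n := by
    intro i h2 h3 h4
    have h5 := hcon i h2 (by omega)
    have h6 : a (i + 1) = 1 := by
      by_contra h7
      exact h5.2.1 h4 (hone_or (i + 1) (by omega) (by omega) h7)
    exact ⟨h6, hone_or (i + 2) (by omega) (by omega) (h5.2.2 h4 h6)⟩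
  -- Either `K` letters `1` lower `ψ` by `K * g`, or a letter `n` occurs among the first `K` and
  -- starts `K` blocks `n, 1`, which raise `ψ` by `K * g`. Both exceed `c - b`. The length `3 * K +
  -- 3` leaves room for the pattern itself.
  by_cases hall : ∀ j < K, a (u + j) = 1
  · have key : ∀ j ≤ K, ψ (u + j) ≤ ψ u - j * g := by
      intro j
      induction j with
      | zero => simp
      | succ j ih =>
        intro hj
        have h2 := ih (by omega)
        have h3 := h1 (u + j) (hall j (by omega))
        rw [← add_assoc]
        push_cast
        linarith
    have h2 := key K le_rfl
    have h3 := (hψ u le_rfl (by omega)).2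
    have h4 := (hψ (u + K) (by omega) (by omega)).1
    linarith
  · push Not at hall
    obtain ⟨j, hj, hj1⟩ := hall
    have hjn := hone_or (u + j) (by omega) (by omega) hj1
    have key : ∀ l ≤ K, a (u + j + 2 * l) = n ∧ ψ (u + j) + l * g ≤ ψ (u + j + 2 * l) := by
      intro l
      induction l with
      | zero => simpa using hjn
      | succ l ih =>
        intro hl
        obtain ⟨h2, h3⟩ := ih (by omega)
        have h4 := hnn (u + j + 2 * l) (by omega) (by omega) h2
        have h5 := hn _ h2 h4.1
        rw [show u + j + 2 * (l + 1) = u + j + 2 * l + 2 by ring]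
        refine ⟨h4.2, ?_⟩
        push_cast
        linarith
    have h2 := (key K le_rfl).2
    have h3 := (hψ (u + j) (by omega) (by omega)).1
    have h4 := (hψ (u + j + 2 * K) (by omega) (by omega)).2
    linarith

section Growth

variable {n : ℕ} {a : ℕ → ℕ}

theorem antinorm_convergent_pos (hn : 5 ≤ n) (ha : ∀ j, 1 ≤ a j) (t : ℕ) :
    0 < antinorm n (convergent a (t + 1)).2 (convergent a t).2 := by
  have h : (0 : ℝ) < (convergent a (t + 1)).2 := by exact_mod_cast convDen_pos ha t
  exact h.trans_le (le_antinorm hn h.le (Nat.cast_nonneg _))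

theorem relativeGrowth_le_succ (hn : 5 ≤ n) (ha : ∀ j, 1 ≤ a j) (han : ∀ j, a j ≤ n) (t : ℕ) :
    relativeGrowth n a t ≤ relativeGrowth n a (t + 1) := by
  have h1 := antinorm_step hn (ha t) (han t) (x := (convergent a (t + 1)).2)
    (y := (convergent a t).2) (Nat.cast_nonneg _) (Nat.cast_nonneg _)
  have h2 := antinorm_convergent_pos hn ha t
  rw [← convergent_den_succ] at h1
  have h3 := Real.log_le_log (by positivity) h1
  rw [Real.log_mul (Real.exp_pos _).ne' h2.ne', Real.log_exp] at h3
  unfold relativeGrowth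
  rw [natSum_succ]
  push_cast
  linarith

/-- The gain in the relative growth at a wasteful pattern. -/
noncomputable def wasteGain (n : ℕ) : ℝ := 1 / (8 * ((n : ℝ) + 2) ^ 2)

theorem wasteGain_le_log {c : ℝ} (hc : 1 + 1 / (4 * ((n : ℝ) + 2) ^ 2) ≤ c) :
    wasteGain n ≤ Real.log c := by
  have h1 : 0 < 1 / (4 * ((n : ℝ) + 2) ^ 2) := by positivity
  rw [Real.le_log_iff_exp_le (by linarith)]
  refine le_trans ?_ hc
  have h3 : 1 / (4 * ((n : ℝ) + 2) ^ 2) = 2 * wasteGain n := by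
    unfold wasteGain; field_simp; norm_num
  have h4 : wasteGain n ≤ 1 / 2 := by
    unfold wasteGain
    apply one_div_le_one_div_of_le (by norm_num)
    nlinarith [(Nat.cast_nonneg n : (0 : ℝ) ≤ n)]
  have h5 : 0 < wasteGain n := by linarith
  have h6 := Real.exp_bound_div_one_sub_of_interval h5.le (by linarith)
  refine h6.trans ?_
  rw [h3, div_le_iff₀ (by linarith)]
  nlinarith

theorem one_add_le_of_five_le (hn : 5 ≤ n) : 1 + 1 / (4 * ((n : ℝ) + 2) ^ 2) ≤ 1.01 := by
  have hn' : (5 : ℝ) ≤ n := by exact_mod_cast hn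
  have : 1 / (4 * ((n : ℝ) + 2) ^ 2) ≤ 1 / 100 := by
    apply one_div_le_one_div_of_le (by norm_num)
    nlinarith
  linarith

theorem relativeGrowth_gain_middle (hn : 5 ≤ n) (ha : ∀ j, 1 ≤ a j) (han : ∀ j, a j ≤ n) {t : ℕ}
    (h1 : a t ≠ 1) (hne : a t ≠ n) :
    relativeGrowth n a t + wasteGain n ≤ relativeGrowth n a (t + 1) := by
  have e0 := antinorm_middle hn (lt_of_le_of_ne (ha t) h1.symm) (lt_of_le_of_ne (han t) hne)
    (x := (convergent a (t + 1)).2) (y := (convergent a t).2) (Nat.cast_nonneg _)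
    (Nat.cast_nonneg _)
  have h2 := antinorm_convergent_pos hn ha t
  rw [← convergent_den_succ] at e0
  have h3 := Real.log_le_log (by positivity) e0
  rw [Real.log_mul (by positivity) h2.ne', Real.log_mul (by positivity) (Real.exp_pos _).ne',
    Real.log_exp] at h3
  have h4 := wasteGain_le_log (n := n) le_rfl
  unfold relativeGrowth
  rw [natSum_succ]
  push_cast
  linarith

theorem mul_convergent_den_le {t : ℕ} (h : a t = n) :
    (n : ℝ) * (convergent a (t + 1)).2 ≤ (convergent a (t + 1 + 1)).2 := by
  rw [convergent_den_succ, h]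
  have : (0 : ℝ) ≤ (convergent a t).2 := Nat.cast_nonneg _
  linarith

theorem relativeGrowth_gain_self_self (hn : 5 ≤ n) (ha : ∀ j, 1 ≤ a j) {t : ℕ}
    (h1 : a t = n) (h2 : a (t + 1) = n) :
    relativeGrowth n a (t + 1) + wasteGain n ≤ relativeGrowth n a (t + 1 + 1) := by
  have e0 := antinorm_self_self hn (Nat.cast_nonneg _) (mul_convergent_den_le h1)
  have e1 := convergent_den_succ a (t + 1)
  rw [h2] at e1
  rw [← e1, ← exp_slope_self hn] at e0
  have e2 := antinorm_convergent_pos hn ha (t + 1)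
  have e3 := Real.log_le_log (by positivity) e0
  rw [Real.log_mul (by positivity) e2.ne', Real.log_mul (by positivity) (Real.exp_pos _).ne',
    Real.log_exp] at e3
  have e4 := wasteGain_le_log (one_add_le_of_five_le hn)
  unfold relativeGrowth
  rw [natSum_succ a (t + 1), h2]
  push_cast
  linarith

theorem relativeGrowth_gain_one_one (hn : 5 ≤ n) (ha : ∀ j, 1 ≤ a j) {t : ℕ}
    (h1 : a t = n) (h2 : a (t + 1) = 1) (h3 : a (t + 2) = 1) :
    relativeGrowth n a (t + 1) + wasteGain n ≤ relativeGrowth n a (t + 1 + 2) := by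
  have e0 := antinorm_one_one hn (Nat.cast_nonneg _) (mul_convergent_den_le h1)
  have d1 := convergent_den_succ a (t + 1)
  have d2 := convergent_den_succ a (t + 1 + 1)
  rw [h2, Nat.cast_one, one_mul] at d1
  rw [show a (t + 1 + 1) = 1 from h3, Nat.cast_one, one_mul] at d2
  rw [← d1, ← d2] at e0
  have h0 := lam_one_pos
  have e2 := antinorm_convergent_pos hn ha (t + 1)
  have e3 := Real.log_le_log (by positivity) e0
  rw [Real.log_mul (by positivity) e2.ne', Real.log_mul (by positivity) h0.ne',
    Real.log_mul (by positivity) h0.ne'] at e3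
  have e4 := wasteGain_le_log (one_add_le_of_five_le hn)
  have e5 := slope_add_offset n
  unfold relativeGrowth
  rw [show t + 1 + 2 = t + 1 + 1 + 1 by ring, natSum_succ a (t + 1 + 1), natSum_succ a (t + 1), h2,
    show a (t + 1 + 1) = 1 from h3]
  push_cast
  linarith

/-- The number `1 / (n + 4)` bounds from below both the loss of excess at a `1` and its gain along
`n, 1`, so the combinatorial lemma applies; monotonicity carries the gain to the ends of the window.
-/
theorem relativeGrowth_gain_window (hn : 5 ≤ n) (ha : ∀ j, 1 ≤ a j) (han : ∀ j, a j ≤ n)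
    {b c : ℝ} (u K : ℕ) (hK : c - b < K * (1 / ((n : ℝ) + 4)))
    (hψ : ∀ i, u ≤ i → i ≤ u + (3 * K + 3) → b ≤ excess n a i ∧ excess n a i ≤ c) :
    relativeGrowth n a u + wasteGain n ≤ relativeGrowth n a (u + (3 * K + 3)) := by
  have hmono := monotone_nat_of_le_succ (relativeGrowth_le_succ hn ha han)
  have hn' : (5 : ℝ) ≤ n := by exact_mod_cast hn
  have hg : 1 / ((n : ℝ) + 4) ≤ 0.118 := by
    rw [div_le_iff₀ (by linarith)]; linarith
  obtain ⟨i, hui, hi, h⟩ := exists_wasteful_pattern (n := n) (a := a) (ψ := excess n a)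
    (g := 1 / ((n : ℝ) + 4))
    (fun i hi => by
      rw [excess_succ_of_one hi]
      linarith [log_lam_one_sub_bound])
    (fun i hi hi1 => by
      rw [show i + 2 = i + 1 + 1 by ring, excess_succ_of_one hi1, excess_succ_of_self hn hi]
      linarith [one_div_le_block_gain hn])
    u K hK hψ
  rcases h with ⟨h1, h2⟩ | ⟨h1, h2⟩ | ⟨h1, h2, h3⟩
  · have := relativeGrowth_gain_middle hn ha han h1 h2
    linarith [hmono hui, hmono (show i + 1 ≤ u + (3 * K + 3) by omega)]
  · have := relativeGrowth_gain_self_self hn ha h1 h2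
    linarith [hmono (show u ≤ i + 1 by omega), hmono (show i + 1 + 1 ≤ u + (3 * K + 3) by omega)]
  · have := relativeGrowth_gain_one_one hn ha h1 h2 h3
    linarith [hmono (show u ≤ i + 1 by omega), hmono (show i + 1 + 2 ≤ u + (3 * K + 3) by omega)]

theorem relativeGrowth_zero_nonneg (hn : 5 ≤ n) : 0 ≤ relativeGrowth n a 0 := by
  have h := le_antinorm hn (x := 1) (y := 0) zero_le_one le_rfl
  have := Real.log_nonneg h
  simpa [relativeGrowth, natSum, convergent] using this

theorem relativeGrowth_le (hn : 5 ≤ n) (ha : ∀ j, 1 ≤ a j) {C : ℝ} (hC : 0 < C)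
    (hq : ∀ t, (convDen a t : ℝ) ^ 2 ≤ C * 2 ^ (∑ j ∈ Finset.range t, a j)) (t : ℕ) :
    relativeGrowth n a t ≤ |Real.log (mu n) + Real.log C / 2| + excess n a t := by
  have hn' : (5 : ℝ) ≤ n := by exact_mod_cast hn
  have hm := mu_bounds hn
  have hq0 : (0 : ℝ) < convDen a t := by exact_mod_cast convDen_pos ha t
  have hle : ((convergent a t).2 : ℝ) ≤ convDen a t := by
    exact_mod_cast convergent_den_le_succ ha t
  have h1 : antinorm n (convergent a (t + 1)).2 (convergent a t).2 ≤ mu n * convDen a t := by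
    refine (min_le_left _ _).trans ?_
    unfold formN
    rw [show ((convergent a (t + 1)).2 : ℝ) = convDen a t from rfl]
    linarith
  have h2 := Real.log_le_log (antinorm_convergent_pos hn ha t) h1
  rw [Real.log_mul (by linarith) hq0.ne'] at h2
  have h3 := Real.log_le_log (by positivity) (hq t)
  rw [Real.log_mul hC.ne' (by positivity), Real.log_pow, Real.log_pow, ← natSum_eq_cast] at h3
  have h4 := le_abs_self (Real.log (mu n) + Real.log C / 2)
  push_cast at h3
  unfold relativeGrowth excess excessScale
  rw [log_sqrt_two]
  linarith

/-- Counting with `N = n + 2`: fewer than `17 N^2 M` windows, each of length at most `12 N M`, cover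
less than `204 N^3 M^2`, far below `t`. -/
theorem not_lt_of_window_bounds {N M B K j t : ℝ} (hN : 7 ≤ N) (hB : 0 ≤ B) (hM : B + 1 ≤ M)
    (hK0 : 0 ≤ K) (hK : K ≤ (N + 2) * (M + B) + 1) (hj : j * (1 / (8 * N ^ 2)) ≤ 2 * M)
    (ht : t = 25600 * N ^ 20 * M ^ 2) : ¬ t < (j + 1) * (3 * K + 3) := by
  intro hlt
  have hM1 : 1 ≤ M := by linarith
  have h6 : j ≤ 16 * N ^ 2 * M := by
    rw [mul_one_div, div_le_iff₀ (by positivity)] at hj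
    linarith
  have h7 : 3 * K + 3 ≤ 12 * N * M := by
    have h1 : (N + 2) * (M + B) ≤ (N + 2) * (2 * M - 1) :=
      mul_le_mul_of_nonneg_left (by linarith) (by linarith)
    have h2 : (N + 2) * (2 * M - 1) ≤ 2 * (N + 2) * M - 9 := by linarith
    have h3 : 7 * M ≤ N * M := mul_le_mul_of_nonneg_right hN (by linarith)
    linarith
  have h8 : j + 1 ≤ 17 * (N ^ 2 * M) := by
    have : 1 ≤ N ^ 2 * M := one_le_mul_of_one_le_of_one_le (one_le_pow₀ (by linarith)) hM1
    linarith
  have h9 : t < 17 * (N ^ 2 * M) * (12 * N * M) :=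
    hlt.trans_le (mul_le_mul h8 h7 (by positivity) (by positivity))
  have h10 : N ^ 3 * M ^ 2 ≤ N ^ 20 * M ^ 2 :=
    mul_le_mul_of_nonneg_right (pow_le_pow_right₀ (by linarith) (by norm_num)) (by positivity)
  have h12 : 17 * (N ^ 2 * M) * (12 * N * M) = 204 * (N ^ 3 * M ^ 2) := by ring
  have h13 : 0 < N ^ 20 * M ^ 2 := by positivity
  rw [h12, ht] at h9
  linarith

/-- If the squares of the denominators are `O(2 ^ S(t))`, then `S(u) - κ_n u` is at least of the
order of `√t` for some `u ≤ t`. -/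
theorem exists_sqrt_le_natSum_sub (hn : 5 ≤ n) (ha : ∀ j, 1 ≤ a j) (han : ∀ j, a j ≤ n) {C : ℝ}
    (hC : 0 < C) (hq : ∀ t, (convDen a t : ℝ) ^ 2 ≤ C * 2 ^ (∑ j ∈ Finset.range t, a j)) :
    ∃ T : ℕ, ∀ t : ℕ, 1 ≤ t → T ≤ t → ∃ u ∈ Finset.Icc 1 t,
      √(t : ℝ) / (160 * ((n : ℝ) + 2) ^ 10) ≤ natSum a u - kappa n * u := by
  set B := |Real.log (mu n) + Real.log C / 2| with hB
  have hB0 : 0 ≤ B := abs_nonneg _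
  have hn' : (5 : ℝ) ≤ n := by exact_mod_cast hn
  -- For `t ≥ T` the assumed bound `M` exceeds `B + 1`, so the implied constant no longer matters.
  obtain ⟨T, hT⟩ := exists_nat_ge ((160 * ((n : ℝ) + 2) ^ 10 * (B + 1)) ^ 2)
  refine ⟨T, fun t ht1 htT => ?_⟩
  by_contra! hcon
  set M := √(t : ℝ) / (160 * ((n : ℝ) + 2) ^ 10) with hM
  have hMB : B + 1 ≤ M := by
    rw [hM, le_div_iff₀ (by positivity), mul_comm]
    apply Real.le_sqrt_of_sq_le
    exact hT.trans (by exact_mod_cast htT)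
  have hM2 : (t : ℝ) = 25600 * ((n : ℝ) + 2) ^ 20 * M ^ 2 := by
    rw [hM, div_pow, Real.sq_sqrt (by positivity)]
    field_simp
    norm_num
  have hup : ∀ u ≤ t, excess n a u ≤ M := by
    intro u hu
    rcases Nat.eq_zero_or_pos u with rfl | hu0
    · rw [excess_zero]; linarith
    · have h1 := hcon u (Finset.mem_Icc.mpr ⟨hu0, hu⟩)
      rw [excess_eq hn]
      have h2 := excessScale_pos hn
      have h3 := excessScale_le_one hn
      rcases le_total 0 (natSum a u - kappa n * u) with h4 | h4 <;> nlinarith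
  have hmono := monotone_nat_of_le_succ (relativeGrowth_le_succ hn ha han)
  have hrel := relativeGrowth_le hn ha hC hq
  have hzero := relativeGrowth_zero_nonneg (a := a) hn
  have hlow : ∀ u, -B ≤ excess n a u := by
    intro u
    have := hrel u
    have := hmono (Nat.zero_le u)
    linarith
  set K := ⌊((n : ℝ) + 4) * (M + B)⌋₊ + 1 with hKdef
  have hK1 : ((n : ℝ) + 4) * (M + B) < K := by
    rw [hKdef]; push_cast; exact Nat.lt_floor_add_one _
  have hK2 : (K : ℝ) ≤ ((n : ℝ) + 4) * (M + B) + 1 := by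
    rw [hKdef]
    push_cast
    have := Nat.floor_le (a := ((n : ℝ) + 4) * (M + B)) (mul_nonneg (by linarith) (by linarith))
    linarith
  set L := 3 * K + 3 with hL
  have hgain : ∀ k : ℕ, k * L ≤ t → k * wasteGain n ≤ relativeGrowth n a (k * L) := by
    intro k
    induction k with
    | zero => intro _; simpa using hzero
    | succ k ih =>
      intro hk
      rw [add_mul, one_mul] at hk ⊢
      have h1 := ih (by omega)
      have h2 := relativeGrowth_gain_window hn ha han (b := -B) (c := M) (k * L) K (by
        rw [mul_one_div, lt_div_iff₀ (by positivity)]; linarith)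
        (fun i _ hi => ⟨hlow i, hup i (by omega)⟩)
      push_cast
      linarith
  have hkL : t / L * L ≤ t := Nat.div_mul_le_self t L
  have h1 := hgain (t / L) hkL
  have h2 := hrel (t / L * L)
  have h3 := hup _ hkL
  have h4 : t < (t / L + 1) * L := by
    have := Nat.lt_div_mul_add (a := t) (b := L) (by omega)
    linarith
  have h5 : (t : ℝ) < ((t / L : ℕ) + 1) * L := by exact_mod_cast h4
  refine not_lt_of_window_bounds (N := n + 2) (by linarith) hB0 hMB (K := K) (by positivity)
    (by linarith) (j := (t / L : ℕ)) ?_ hM2 ?_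
  · change ((t / L : ℕ) : ℝ) * wasteGain n ≤ 2 * M
    linarith
  · rw [hL] at h5
    push_cast at h5
    exact h5

end Growth

/-! ### A sequence of partial quotients with slowly growing excess -/

/-- The loss of the excess at a partial quotient `1`. -/
noncomputable def lossOne : ℝ := Real.log (lam 1) - Real.log (√2)

/-- The gain of the excess at a partial quotient `n`. -/
noncomputable def gainSelf (n : ℕ) : ℝ := n * Real.log (√2) - (Real.log (mu n) - Real.log (lam 1))

/-- The gain of the excess along the block `n, 1`. -/
noncomputable def blockGain (n : ℕ) : ℝ := gainSelf n - lossOne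

theorem blockGain_eq (n : ℕ) :
    blockGain n = (n + 1) * Real.log (√2) - Real.log (mu n) := by
  unfold blockGain gainSelf lossOne; ring

/-- The state of the construction of the sequence: the number of the stage, the number of partial
quotients still to be written in the current run of blocks `n, 1`, and the present excess. After the
run, partial quotients `1` are written until the excess is at most the number of the stage. -/
structure StageState where
  stage : ℕ
  left : ℕ
  level : ℝ

/-- The partial quotient written in a state. -/
noncomputable def StageState.letter (n : ℕ) (s : StageState) : ℕ :=
  open Classical in
  if s.left = 0 then if (s.stage : ℝ) < s.level then 1 else n
  else if Even s.left then n else 1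

/-- The next state; the run of stage `j` consists of `j + d` blocks. -/
noncomputable def StageState.next (n d : ℕ) (s : StageState) : StageState :=
  open Classical in
  if s.left = 0 then
    if (s.stage : ℝ) < s.level then ⟨s.stage, 0, s.level - lossOne⟩
    else ⟨s.stage + 1, 2 * (s.stage + d) + 1, s.level + gainSelf n⟩
  else if Even s.left then ⟨s.stage, s.left - 1, s.level + gainSelf n⟩
  else ⟨s.stage, s.left - 1, s.level - lossOne⟩

/-- The sequence of states. -/
noncomputable def stageState (n d : ℕ) : ℕ → StageState
  | 0 => ⟨0, 0, 0⟩
  | t + 1 => (stageState n d t).next n d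

/-- The sequence of partial quotients. -/
noncomputable def stageSeq (n d : ℕ) (t : ℕ) : ℕ := (stageState n d t).letter n

theorem stageSeq_eq_or (n d t : ℕ) : stageSeq n d t = 1 ∨ stageSeq n d t = n := by
  unfold stageSeq StageState.letter
  split_ifs <;> simp

/-- The product of the weights of the first `t` partial quotients. -/
noncomputable def weight (n : ℕ) (a : ℕ → ℕ) (t : ℕ) : ℝ :=
  Real.exp (slope n * natSum a t + offset n * t)

theorem weight_succ (n : ℕ) (a : ℕ → ℕ) (t : ℕ) :
    weight n a (t + 1) = Real.exp (slope n * a t + offset n) * weight n a t := by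
  unfold weight
  rw [← Real.exp_add, natSum_succ]
  push_cast
  ring_nf

theorem weight_pos (n : ℕ) (a : ℕ → ℕ) (t : ℕ) : 0 < weight n a t := Real.exp_pos _

/-- The bounds for the excess `ψ` and for the pair `(x, y) = (q_t, q_{t-1})` of denominators in a
state with stage `j` and `m` partial quotients left in the run, where `w` is the weight. -/
def StageBounds (n d j m : ℕ) (ψ x y w : ℝ) : Prop :=
  (m = 0 ∧ j - lossOne ≤ ψ ∧ ψ ≤ j + (j + d) * blockGain n ∧
    lam 1 * x + y ≤ lam 1 ^ (j + 2) * w) ∨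
  (∃ k i : ℕ, m = 2 * k + 2 ∧ k + 1 + i = j + d ∧ j - 1 - lossOne + i * blockGain n ≤ ψ ∧
    ψ ≤ j + i * blockGain n ∧ formN n x y ≤ mu n * lam 1 ^ j * w) ∨
  (∃ k i : ℕ, m = 2 * k + 1 ∧ k + 1 + i = j + d ∧
    j - 1 - lossOne + i * blockGain n + gainSelf n ≤ ψ ∧
    ψ ≤ j + i * blockGain n + gainSelf n ∧ formOne n x y ≤ mu n * lam 1 ^ j * w)

theorem blockGain_pos {n : ℕ} (hn : 5 ≤ n) : 0 < blockGain n := by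
  rw [blockGain_eq]
  exact lt_of_lt_of_le (by positivity) (one_div_le_block_gain hn)

theorem lossOne_pos : 0 < lossOne := lt_of_lt_of_le (by norm_num) log_lam_one_sub_bound

theorem gainSelf_pos {n : ℕ} (hn : 5 ≤ n) : 0 < gainSelf n := by
  have h1 := blockGain_pos hn
  have h2 := lossOne_pos
  unfold blockGain at h1
  linarith

/-- `λ₁ x + y` is the eigenform of the letter `1`. This lemma passes to it at the end of a run of
blocks, `formN_le_lam_form` passes back at the start of the next; the round trip costs one factor
`λ₁`. -/
theorem lam_form_le_formN {n : ℕ} (hn : 5 ≤ n) {x y : ℝ} (hxy : y ≤ x) :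
    mu n * (lam 1 * x + y) ≤ lam 1 ^ 2 * formN n x y := by
  have hn' : (5 : ℝ) ≤ n := by exact_mod_cast hn
  have hl := lam_one_bounds
  have hm := mu_bounds hn
  have h1 : 0 ≤ (mu n - lam 1 ^ 2) * (x - y) :=
    mul_nonneg (by rw [lam_one_sq]; linarith) (by linarith)
  have h2 : lam 1 ^ 2 * formN n x y - mu n * (lam 1 * x + y)
      = (mu n - lam 1 ^ 2) * (x - y) + mu n * x * (lam 1 ^ 2 - lam 1 - 1) := by
    unfold formN; ring
  rw [lam_one_sq] at h2 h1 ⊢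
  linarith

theorem formN_le_lam_form {n : ℕ} (hn : 5 ≤ n) {x y : ℝ} (hx : 0 ≤ x) (hy : 0 ≤ y) :
    lam 1 * formN n x y ≤ mu n * (lam 1 * x + y) := by
  have hn' : (5 : ℝ) ≤ n := by exact_mod_cast hn
  have hl := lam_one_bounds
  have hm := mu_bounds hn
  unfold formN
  have h1 : 0 ≤ lam 1 * x := mul_nonneg (by linarith) hx
  have h2 : lam 1 * y ≤ mu n * y := mul_le_mul_of_nonneg_right (by linarith) hy
  linarith

theorem stageBounds_one_of_zero {n d j : ℕ} {ψ x y w : ℝ}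
    (h : StageBounds n d j 0 ψ x y w) (hψ : j < ψ) :
    StageBounds n d j 0 (ψ - lossOne) (x + y) x (lam 1 * w) := by
  have h0 := lossOne_pos
  rcases h with ⟨-, h1, h2, h3⟩ | ⟨k, i, h, -⟩ | ⟨k, i, h, -⟩
  · refine Or.inl ⟨rfl, by linarith, by linarith, ?_⟩
    have h4 := mul_le_mul_of_nonneg_left h3 lam_one_pos.le
    have h5 : lam 1 * (x + y) + x = lam 1 * (lam 1 * x + y) := by
      linear_combination -x * lam_one_sq
    rw [h5]
    linarith
  · omega
  · omega

theorem stageBounds_self_of_zero {n d j : ℕ} (hn : 5 ≤ n) {ψ x y w : ℝ} (hx : 0 ≤ x) (hy : 0 ≤ y)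
    (h : StageBounds n d j 0 ψ x y w) (hψ : ψ ≤ j) :
    StageBounds n d (j + 1) (2 * (j + d) + 1) (ψ + gainSelf n) (n * x + y) x
      (mu n / lam 1 * w) := by
  have h0 := lam_one_pos
  have hn' : (5 : ℝ) ≤ n := by exact_mod_cast hn
  have hm := mu_bounds hn
  rcases h with ⟨-, h1, h2, h3⟩ | ⟨k, i, h, -⟩ | ⟨k, i, h, -⟩
  · refine Or.inr (Or.inr ⟨j + d, 0, rfl, by ring, ?_, ?_, ?_⟩)
    · push_cast; linarith
    · push_cast; linarith
    · have h4 : lam 1 * formN n x y ≤ mu n * (lam 1 ^ (j + 2) * w) :=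
        (formN_le_lam_form hn hx hy).trans (mul_le_mul_of_nonneg_left h3 (by linarith))
      have h5 : formN n x y ≤ mu n * lam 1 ^ (j + 1) * w := by
        refine le_of_mul_le_mul_left (h4.trans_eq ?_) h0
        ring
      rw [formOne_self]
      refine (mul_le_mul_of_nonneg_left h5 (div_nonneg (by linarith) h0.le)).trans_eq ?_
      ring
  · omega
  · omega

theorem stageBounds_self_of_even {n d j m : ℕ} (hn : 5 ≤ n) {ψ x y w : ℝ} (hm0 : m ≠ 0)
    (hm : Even m) (h : StageBounds n d j m ψ x y w) :
    StageBounds n d j (m - 1) (ψ + gainSelf n) (n * x + y) x (mu n / lam 1 * w) := by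
  have h0 := lam_one_pos
  have hn' : (5 : ℝ) ≤ n := by exact_mod_cast hn
  have hmu := mu_bounds hn
  rcases h with ⟨h, -⟩ | ⟨k, i, h1, h2, h3, h4, h5⟩ | ⟨k, i, h, -⟩
  · exact absurd h hm0
  · refine Or.inr (Or.inr ⟨k, i, by omega, h2, by linarith, by linarith, ?_⟩)
    rw [formOne_self]
    refine (mul_le_mul_of_nonneg_left h5 (div_nonneg (by linarith) h0.le)).trans_eq ?_
    ring
  · rw [h] at hm
    exact absurd hm (by simp)

theorem stageBounds_one_of_odd {n d j m : ℕ} (hn : 5 ≤ n) (hd : 1 ≤ d * blockGain n)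
    {ψ x y w : ℝ} (hy : 0 ≤ y) (hm0 : m ≠ 0) (hm : ¬ Even m)
    (h : StageBounds n d j m ψ x y w) :
    StageBounds n d j (m - 1) (ψ - lossOne) (x + y) x (lam 1 * w) := by
  have h0 := lam_one_pos
  have hn' : (5 : ℝ) ≤ n := by exact_mod_cast hn
  have hmu := mu_bounds hn
  have hG := blockGain_pos hn
  have hGeq : blockGain n = gainSelf n - lossOne := rfl
  rcases h with ⟨h, -⟩ | ⟨k, i, h, -⟩ | ⟨k, i, h1, h2, h3, h4, h5⟩
  · exact absurd h hm0
  · rw [h] at hm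
    exact absurd (by simp [Nat.even_add, parity_simps]) hm
  · have h6 : formN n (x + y) x ≤ mu n * lam 1 ^ j * (lam 1 * w) := by
      rw [formN_one]
      exact (mul_le_mul_of_nonneg_left h5 h0.le).trans_eq (by ring)
    rcases k with _ | k
    · have h7 : (i : ℝ) + 1 = j + d := by
        have : i + 1 = j + d := by omega
        exact_mod_cast this
      have h8 : (0 : ℝ) ≤ j * blockGain n := by positivity
      refine Or.inl ⟨by omega, ?_, ?_, ?_⟩
      · have : (i : ℝ) * blockGain n = j * blockGain n + d * blockGain n - blockGain n := by
          linear_combination blockGain n * h7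
        linarith
      · rw [← h7]; linarith
      · have h9 := lam_form_le_formN hn (x := x + y) (y := x) (by linarith)
        have h10 : mu n * (lam 1 * (x + y) + x) ≤ mu n * (lam 1 ^ (j + 2) * (lam 1 * w)) := by
          refine h9.trans ((mul_le_mul_of_nonneg_left h6 (by positivity)).trans_eq ?_)
          ring
        exact le_of_mul_le_mul_left h10 (by linarith)
    · refine Or.inr (Or.inl ⟨k, i + 1, by omega, by omega, ?_, ?_, h6⟩)
      · push_cast; linarith
      · push_cast; linarith

/-- The invariant of the construction. -/
theorem stageState_invariant {n d : ℕ} (hn : 5 ≤ n) (hd : 1 ≤ d * blockGain n) (t : ℕ) :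
    excess n (stageSeq n d) t = (stageState n d t).level ∧
    (stageState n d t).stage * ((stageState n d t).stage + 1) ≤ t + (stageState n d t).left ∧
    lossOne * t + (stageState n d t).level + (lossOne + gainSelf n) * (stageState n d t).left
      ≤ (lossOne + gainSelf n) * ((stageState n d t).stage + d + 1) ^ 2 ∧
    StageBounds n d (stageState n d t).stage (stageState n d t).left (stageState n d t).level
      (convergent (stageSeq n d) (t + 1)).2 (convergent (stageSeq n d) t).2
      (weight n (stageSeq n d) t) := by
  have hb := lossOne_pos
  have hz := gainSelf_pos hn
  have h0 := lam_one_bounds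
  induction t with
  | zero =>
    refine ⟨excess_zero _ _, by simp [stageState], ?_, Or.inl ⟨rfl, ?_, ?_, ?_⟩⟩
    · simp only [stageState]
      push_cast
      have : 0 ≤ (lossOne + gainSelf n) * (0 + d + 1) ^ 2 := by positivity
      linarith
    · simp [stageState, hb.le]
    · have := blockGain_pos hn
      simp only [stageState]
      push_cast
      nlinarith
    · have : weight n (stageSeq n d) 0 = 1 := by simp [weight, natSum]
      rw [this]
      simp only [stageState, convergent]
      push_cast
      nlinarith [lam_one_sq]
  | succ t ih =>
    obtain ⟨h1, h2, h3, h4⟩ := ih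
    have hden := convergent_den_succ (stageSeq n d) t
    have hone : stageSeq n d t = 1 →
        excess n (stageSeq n d) (t + 1) = (stageState n d t).level - lossOne ∧
        ((convergent (stageSeq n d) (t + 1 + 1)).2 : ℝ)
          = (convergent (stageSeq n d) (t + 1)).2 + (convergent (stageSeq n d) t).2 ∧
        weight n (stageSeq n d) (t + 1) = lam 1 * weight n (stageSeq n d) t := by
      intro h
      refine ⟨by rw [excess_succ_of_one h, h1]; rfl, by rw [hden, h]; simp, ?_⟩
      rw [weight_succ, h, exp_slope_one]
    have hself : stageSeq n d t = n →
        excess n (stageSeq n d) (t + 1) = (stageState n d t).level + gainSelf n ∧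
        ((convergent (stageSeq n d) (t + 1 + 1)).2 : ℝ)
          = n * (convergent (stageSeq n d) (t + 1)).2 + (convergent (stageSeq n d) t).2 ∧
        weight n (stageSeq n d) (t + 1) = mu n / lam 1 * weight n (stageSeq n d) t := by
      intro h
      refine ⟨by rw [excess_succ_of_self hn h, h1]; rfl, by rw [hden, h], ?_⟩
      rw [weight_succ, h, exp_slope_self hn]
    have hx : (0 : ℝ) ≤ (convergent (stageSeq n d) (t + 1)).2 := Nat.cast_nonneg _
    have hy : (0 : ℝ) ≤ (convergent (stageSeq n d) t).2 := Nat.cast_nonneg _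
    have hst : stageState n d (t + 1) = (stageState n d t).next n d := rfl
    have hlet : stageSeq n d t = (stageState n d t).letter n := rfl
    generalize stageState n d t = s at *
    obtain ⟨j, m, ψ⟩ := s
    simp only [StageState.next, StageState.letter] at hst hlet
    simp only at h2 h3 h4 hone hself
    by_cases hm : m = 0
    · subst hm
      simp only [if_true] at hst hlet
      by_cases hψ : (j : ℝ) < ψ
      · rw [if_pos hψ] at hst hlet
        obtain ⟨e1, e2, e3⟩ := hone hlet
        rw [hst, e1, e2, e3]
        refine ⟨rfl, h2.trans (by simp), ?_, stageBounds_one_of_zero h4 hψ⟩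
        push_cast at h3 ⊢
        linarith
      · rw [if_neg hψ] at hst hlet
        obtain ⟨e1, e2, e3⟩ := hself hlet
        rw [hst, e1, e2, e3]
        refine ⟨rfl, ?_, ?_, stageBounds_self_of_zero hn hx hy h4 (not_lt.mp hψ)⟩
        · simp only
          nlinarith
        · push_cast at h3 ⊢
          -- Only the start of a stage increases the left side of the third clause, by `2 * (j + d)
          -- + 2` times `lossOne + gainSelf n`; the square grows by one unit more.
          have h5 : ((j : ℝ) + 1 + d + 1) ^ 2 = (j + d + 1) ^ 2 + 2 * (j + d) + 3 := by ring
          rw [h5]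
          linarith
    · simp only [if_neg hm] at hst hlet
      have hcast : ((m - 1 : ℕ) : ℝ) = m - 1 := by
        rw [Nat.cast_sub (Nat.one_le_iff_ne_zero.mpr hm)]; simp
      by_cases hev : Even m
      · rw [if_pos hev] at hst hlet
        obtain ⟨e1, e2, e3⟩ := hself hlet
        rw [hst, e1, e2, e3]
        refine ⟨rfl, h2.trans (by simp only; omega), ?_, stageBounds_self_of_even hn hm hev h4⟩
        simp only
        rw [hcast]
        push_cast
        linarith
      · rw [if_neg hev] at hst hlet
        obtain ⟨e1, e2, e3⟩ := hone hlet
        rw [hst, e1, e2, e3]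
        refine ⟨rfl, h2.trans (by simp only; omega), ?_,
          stageBounds_one_of_odd hn hd hy hm hev h4⟩
        simp only
        rw [hcast]
        push_cast
        linarith

theorem StageBounds.summary {n d j m : ℕ} (hn : 5 ≤ n) {ψ x y w : ℝ} (hx : 0 ≤ x) (hy : 0 ≤ y)
    (hw : 0 ≤ w) (h : StageBounds n d j m ψ x y w) :
    m ≤ 2 * (j + d) ∧ j - 1 - lossOne ≤ ψ ∧ ψ ≤ j + (j + d) * blockGain n + gainSelf n ∧
      x ≤ mu n * lam 1 ^ (j + 2) * w := by
  have hn' : (5 : ℝ) ≤ n := by exact_mod_cast hn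
  have hl := lam_one_bounds
  have hm := mu_bounds hn
  have hG := blockGain_pos hn
  have hz := gainSelf_pos hn
  have hN := le_antinorm hn hx hy
  have hpow : mu n * lam 1 ^ j * w ≤ mu n * lam 1 ^ (j + 2) * w := by
    gcongr
    · linarith
    · linarith
    · omega
  rcases h with ⟨h1, h2, h3, h4⟩ | ⟨k, i, h1, h2, h3, h4, h5⟩ | ⟨k, i, h1, h2, h3, h4, h5⟩
  · refine ⟨by omega, by linarith, by linarith, ?_⟩
    have h5 : 0 ≤ lam 1 ^ (j + 2) * w := mul_nonneg (pow_nonneg (by linarith) _) hw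
    have h6 : x ≤ lam 1 * x + y := by nlinarith
    nlinarith
  all_goals
    have hi : (i : ℝ) * blockGain n ≤ (j + d) * blockGain n := by
      have : i ≤ j + d := by omega
      have : (i : ℝ) ≤ j + d := by exact_mod_cast this
      gcongr
    have hi0 : 0 ≤ (i : ℝ) * blockGain n := by positivity
  · exact ⟨by omega, by linarith, by linarith,
      (hN.trans (min_le_left _ _)).trans (h5.trans hpow)⟩
  · exact ⟨by omega, by linarith, by linarith,
      (hN.trans (min_le_right _ _)).trans (h5.trans hpow)⟩

/-- The third clause of the invariant bounds `lossOne * t + level` in terms of the stage, and the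
level is bounded below; so `t` is bounded while the stage is. -/
theorem tendsto_stage {n d : ℕ} (hn : 5 ≤ n) (hd : 1 ≤ d * blockGain n) :
    Tendsto (fun t => (stageState n d t).stage) atTop atTop := by
  have hb := lossOne_pos
  have hz := gainSelf_pos hn
  rw [tendsto_atTop]
  intro J
  obtain ⟨T, hT⟩ := exists_nat_gt
    (((lossOne + gainSelf n) * (J + d + 1) ^ 2 + 1 + lossOne) / lossOne)
  filter_upwards [eventually_ge_atTop T] with t ht
  by_contra! hJ
  obtain ⟨-, -, h3, h4⟩ := stageState_invariant hn hd t
  have h5 := (h4.summary hn (Nat.cast_nonneg _) (Nat.cast_nonneg _) (weight_pos _ _ _).le).2.1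
  rw [div_lt_iff₀ hb] at hT
  have h6 : (T : ℝ) ≤ t := by exact_mod_cast ht
  have h7 : ((stageState n d t).stage : ℝ) ≤ J := by exact_mod_cast hJ.le
  have h8 : (lossOne + gainSelf n) * (((stageState n d t).stage : ℝ) + d + 1) ^ 2
      ≤ (lossOne + gainSelf n) * (J + d + 1) ^ 2 := by gcongr
  have h9 : 0 ≤ (lossOne + gainSelf n) * ((stageState n d t).left : ℝ) := by positivity
  have h10 : (0 : ℝ) ≤ (stageState n d t).stage := Nat.cast_nonneg _
  nlinarith

theorem sqrt_two_pow_eq {n : ℕ} (a : ℕ → ℕ) (t : ℕ) :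
    (2 : ℝ) ^ (∑ j ∈ Finset.range t, a j) = (weight n a t * Real.exp (excess n a t)) ^ 2 := by
  have h1 : weight n a t * Real.exp (excess n a t) = Real.exp (natSum a t * (Real.log 2 / 2)) := by
    unfold weight excess excessScale
    rw [← Real.exp_add, log_sqrt_two]
    ring_nf
  rw [h1, ← Real.exp_nat_mul, natSum_eq_cast]
  rw [show ((2 : ℕ) : ℝ) * (((∑ j ∈ Finset.range t, a j : ℕ) : ℝ) * (Real.log 2 / 2))
    = ((∑ j ∈ Finset.range t, a j : ℕ) : ℝ) * Real.log 2 by push_cast; ring,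
    Real.exp_nat_mul, Real.exp_log (by norm_num)]

theorem tendsto_convDen_stageSeq {n d : ℕ} (hn : 5 ≤ n) (hd : 1 ≤ d * blockGain n) :
    Tendsto (fun t => (convDen (stageSeq n d) t : ℝ) ^ 2
      / 2 ^ (∑ j ∈ Finset.range t, stageSeq n d j)) atTop (𝓝 0) := by
  have hl := lam_one_bounds
  have hn' : (5 : ℝ) ≤ n := by exact_mod_cast hn
  have hm := mu_bounds hn
  -- Per stage the bound for `q_t` over the weights grows by `λ₁`, and the lower bound for `exp
  -- (excess)` by `e`.
  set r : ℝ := lam 1 / Real.exp 1 with hr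
  have hr0 : 0 ≤ r := div_nonneg (by linarith) (Real.exp_pos 1).le
  have hr1 : r < 1 := by
    rw [hr, div_lt_one (Real.exp_pos 1)]
    linarith [Real.add_one_le_exp (1 : ℝ)]
  have hlim : Tendsto (fun t => (mu n * lam 1 ^ 2 * Real.exp (1 + lossOne)
      * r ^ (stageState n d t).stage) ^ 2) atTop (𝓝 0) := by
    have := (((tendsto_pow_atTop_nhds_zero_of_lt_one hr0 hr1).comp
      (tendsto_stage hn hd)).const_mul (mu n * lam 1 ^ 2 * Real.exp (1 + lossOne))).pow 2
    simpa using this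
  refine squeeze_zero (fun t => by positivity) (fun t => ?_) hlim
  obtain ⟨h1, -, -, h4⟩ := stageState_invariant hn hd t
  have hw := weight_pos n (stageSeq n d) t
  obtain ⟨-, h5, -, h6⟩ := h4.summary hn (Nat.cast_nonneg _) (Nat.cast_nonneg _) hw.le
  rw [sqrt_two_pow_eq (n := n), ← div_pow]
  refine pow_le_pow_left₀ (div_nonneg (Nat.cast_nonneg _) (by positivity)) ?_ 2
  rw [div_le_iff₀ (by positivity), h1]
  set j := (stageState n d t).stage
  have h7 : Real.exp (j - 1 - lossOne) ≤ Real.exp (stageState n d t).level :=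
    Real.exp_le_exp.mpr h5
  have h8 : Real.exp (1 + lossOne) * r ^ j * Real.exp (j - 1 - lossOne) = lam 1 ^ j := by
    have : Real.exp (j - 1 - lossOne) = Real.exp 1 ^ j / Real.exp (1 + lossOne) := by
      rw [← Real.exp_nat_mul, ← Real.exp_sub]
      ring_nf
    rw [this, hr, div_pow]
    field_simp
  calc (convDen (stageSeq n d) t : ℝ) ≤ mu n * lam 1 ^ (j + 2) * weight n (stageSeq n d) t := h6
    _ = mu n * lam 1 ^ 2 * Real.exp (1 + lossOne) * r ^ j
        * (weight n (stageSeq n d) t * Real.exp (j - 1 - lossOne)) := by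
        rw [pow_add, ← h8]; ring
    _ ≤ _ := by
        gcongr
        have : 0 ≤ mu n := by linarith
        positivity

theorem natSum_stageSeq_sub_le {n d : ℕ} (hn : 5 ≤ n) (hd : 1 ≤ d * blockGain n) :
    ∃ T : ℕ, ∀ t : ℕ, T ≤ t →
      natSum (stageSeq n d) t - kappa n * t ≤ 15 * n * √(t : ℝ) := by
  have hG := blockGain_pos hn
  have hz := gainSelf_pos hn
  have hn' : (5 : ℝ) ≤ n := by exact_mod_cast hn
  have hD := excessScale_pos hn
  have hDn := excessScale_mul_sub_one hn
  rw [← blockGain_eq] at hDn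
  have hlog := log_lam_one_sub_bound
  set c : ℝ := d * blockGain n + gainSelf n with hc
  -- Since `0.236 * 5 > 1`, this makes `0.236 * (j - 15)` absorb `c`, the part of the excess bound
  -- independent of `j`. The extra `1 + 2 * d` below gives `(j - 1) ^ 2 ≤ t`.
  obtain ⟨J, hJ⟩ := exists_nat_gt (15 + 5 * c)
  obtain ⟨T, hT⟩ := eventually_atTop.mp ((tendsto_stage hn hd).eventually_ge_atTop (J + 1 + 2 * d))
  refine ⟨T, fun t ht => ?_⟩
  have hj := hT t ht
  obtain ⟨h1, h2, -, h4⟩ := stageState_invariant hn hd t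
  obtain ⟨h5, -, h6, -⟩ := h4.summary hn (Nat.cast_nonneg _) (Nat.cast_nonneg _)
    (weight_pos n (stageSeq n d) t).le
  set j := (stageState n d t).stage
  rw [← h1, excess_eq hn] at h6
  have hjd : (1 : ℝ) + 2 * d ≤ j := by
    have : 1 + 2 * d ≤ j := by omega
    exact_mod_cast this
  have hjJ : (J : ℝ) ≤ j := by
    have : J ≤ j := by omega
    exact_mod_cast this
  have hsqrt : (j : ℝ) - 1 ≤ √(t : ℝ) := by
    apply Real.le_sqrt_of_sq_le
    have h7 : j * (j + 1) ≤ t + 2 * (j + d) := by omega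
    have h8 : (j : ℝ) * (j + 1) ≤ t + 2 * (j + d) := by exact_mod_cast h7
    nlinarith
  set D := excessScale n
  have e1 : 0.236 ≤ n * D := by nlinarith
  have e2 : blockGain n ≤ n * D := by nlinarith
  have e3 : 15 * (n * D) * (j - 1) ≤ 15 * (n * D) * √(t : ℝ) := by gcongr
  have e4 : 0.236 * (j - 15) ≤ n * D * (j - 15) :=
    mul_le_mul_of_nonneg_right e1 (by have : 0 ≤ c := by positivity
                                      linarith)
  have e5 : j * (1 + blockGain n) ≤ j * (14 * (n * D)) := by
    gcongr
    linarith
  have e6 : D * (natSum (stageSeq n d) t - kappa n * t) ≤ D * (15 * n * √(t : ℝ)) := by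
    linarith
  exact le_of_mul_le_mul_left e6 hD

theorem exists_seq_tendsto_and_natSum_sub_le {n : ℕ} (hn : 5 ≤ n) :
    ∃ a : ℕ → ℕ, (∀ j, 1 ≤ a j) ∧ (∀ j, a j ≤ n) ∧
      Tendsto (fun t => (convDen a t : ℝ) ^ 2 / 2 ^ (∑ j ∈ Finset.range t, a j)) atTop (𝓝 0) ∧
      ∃ T : ℕ, ∀ t : ℕ, T ≤ t → natSum a t - kappa n * t ≤ 15 * n * √(t : ℝ) := by
  have hG := blockGain_pos hn
  -- For `n = 5` the gain of a block is small, so `d` additional blocks ensure that each run reaches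
  -- the new threshold.
  obtain ⟨d, hd⟩ := exists_nat_gt (1 / blockGain n)
  rw [div_lt_iff₀ hG] at hd
  refine ⟨stageSeq n d, fun j => ?_, fun j => ?_, tendsto_convDen_stageSeq hn hd.le,
    natSum_stageSeq_sub_le hn hd.le⟩
  · rcases stageSeq_eq_or n d j with h | h <;> omega
  · rcases stageSeq_eq_or n d j with h | h <;> omega

end Minkowski

/-! ### The theorem: transfer between numbers and sequences of partial quotients -/

theorem theorem6 (n : ℕ) (hn : 5 ≤ n) :
    (∀ x ∈ Minkowski.boundedQuotients n, HasDerivAt Minkowski.questionMark 0 x →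
      ∃ T : ℕ, ∀ (t : ℕ) (ht : 1 ≤ t), T ≤ t →
        √(t : ℝ) / (160 * ((n : ℝ) + 2) ^ 10) ≤
          (Finset.Icc 1 t).sup' (Finset.nonempty_Icc.mpr ht)
            (fun u : ℕ => Minkowski.quotientSum x u - Minkowski.kappa n * (u : ℝ))) ∧
    (∃ x ∈ Minkowski.boundedQuotients n, HasDerivAt Minkowski.questionMark 0 x ∧
      ∃ T : ℕ, ∀ t : ℕ, T ≤ t →
        Minkowski.quotientSum x t - Minkowski.kappa n * (t : ℝ) ≤
          15 * (n : ℝ) * √(t : ℝ)) := by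
  constructor
  · rintro x ⟨hx, hirr, hle⟩ hd
    obtain ⟨a, z, hz, ha, rfl⟩ := Minkowski.exists_isExpansion_of_irrational hx hirr
    have hpq := (Minkowski.partialQuotient_eq_of_isExpansion hz).1
    have han : ∀ j, a j ≤ n := fun j => by
      have := hle j
      rw [hpq] at this
      exact_mod_cast this
    obtain ⟨C, hC, hq⟩ := hz.convDen_sq_le ha han hd
    obtain ⟨T, hT⟩ := Minkowski.exists_sqrt_le_natSum_sub hn ha han hC hq
    refine ⟨T, fun t ht htT => ?_⟩
    obtain ⟨u, hu, h⟩ := hT t ht htT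
    refine (Finset.le_sup'_iff _).mpr ⟨u, hu, ?_⟩
    simpa only [Minkowski.quotientSum, Minkowski.natSum, hpq] using h
  · obtain ⟨a, ha, han, hlim, T, hT⟩ := Minkowski.exists_seq_tendsto_and_natSum_sub_le hn
    obtain ⟨z, hz⟩ := Minkowski.exists_isExpansion ha
    obtain ⟨hpq, hirr⟩ := Minkowski.partialQuotient_eq_of_isExpansion hz
    refine ⟨z 0, ⟨⟨(hz 0).1, (hz 0).2.1⟩, hirr, fun j => ?_⟩, hz.hasDerivAt_zero ha han hlim, T,
      fun t ht => ?_⟩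
    · rw [hpq]
      exact_mod_cast han j
    · simpa only [Minkowski.quotientSum, Minkowski.natSum, hpq] using hT t ht
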